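/- **Setting.** Let $0<b\le\infty$, $I=[0,b)$ and $m\ge 1$. Let $HK_{loc}(I)$ be the space of locally Henstock–Kurzweil (HK) integrable functions $I\to\mathbb R$ (HK integrable on each compact subinterval of $I$), with a.e. equal functions identified and with the a.e. pointwise order; $HK_{loc}(I)^m$ is ordered componentwise. Let $\mathcal D^{lr}(I)$ be the set of functions $H:I\to\mathbb R$ that are locally HK integrable, have a left limit at each point of $(0,b)$ and have a right limit at $0$, and let $\mathcal D^{lc}(I)$ be the set of those $H\in\mathcal D^{lr}(I)$ that are left continuous on $(0,b)$ and right continuous at $0$, ordered pointwise. Distributions are continuous linear functionals on the smooth functions with compact support in $(0,b)$. A function $H\in\mathcal D^{lr}(I)$ determines the distribution $\langle H,\varphi\rangle=\int_I H\varphi$ (HK integral) and has the distributional derivative $\langle H',\varphi\rangle=-\int_I H\varphi'$. Let $\mathcal A_D(I)$ be the set of distributions $H'$ with $H\in\mathcal D^{lr}(I)$. Each $f\in\mathcal A_D(I)$ has exactly one primitive $\mathcal F(f)\in\mathcal D^{lc}(I)$ with $\mathcal F(f)(0+)=0$; write $f\preceq h$ if $\mathcal F(f)\le\mathcal F(h)$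 pointwise on $I$. Let $S_D$ be the set of functions $y:I\to\mathbb R$ with $y^{(m-1)}\in\mathcal D^{lc}(I)$, meaning that there are (necessarily unique) functions $y^{(0)}=y,\ y^{(1)},\dots,y^{(m-1)}$ in $\mathcal D^{lc}(I)$ such that $y^{(i+1)}$ is the distributional derivative of $y^{(i)}$ for $0\le i<m-1$. Order $S_D$ by: $y\le z$ iff $y^{(i)}(t)\le z^{(i)}(t)$ for all $t\in I$ and $i=0,\dots,m-1$. For $y\in S_D$ let $y^{(m)}$ be the distributional derivative of $y^{(m-1)}$, so that $y^{(m)}\in\mathcal A_D(I)$. For $g:HK_{loc}(I)^m\to\mathcal A_D(I)$ and $c=(c_1,\dots,c_m)\in\mathbb R^m$ consider the Cauchy problem $$y^{(m)}=g(y,y',\dots,y^{(m-1)}),\qquad y^{(i)}(0)=c_{i+1}\quad(i=0,\dots,m-1).\tag{$P_{g,c}$}$$ A function $y\in S_D$ is a *solution* of $(P_{g,c})$ if these equations hold, a *subsolution* if $y^{(m)}\preceq g(y,\dots,y^{(m-1)})$ and $y^{(i)}(0)\le c_{i+1}$ for $i=0,\dots,m-1$, and a *supersolution* if the reversed inequalities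 hold. The map $g$ is *increasing* if $x\le z$ in $HK_{loc}(I)^m$ implies $g(x)\preceq g(z)$. **Theorem.** 1. Assume that $g:HK_{loc}(I)^m\to\mathcal A_D(I)$ is increasing and that $(P_{g,c})$ has a subsolution $\underline y\in S_D$ and a supersolution $\overline y\in S_D$ with $\underline y\le\overline y$ in $S_D$. Then $(P_{g,c})$ has a smallest solution and a greatest solution in the order interval $[\underline y,\overline y]=\{y\in S_D:\underline y\le y\le\overline y\}$ of $S_D$. 2. These solutions are increasing with respect to $g$ and $c_1,\dots,c_m$. That is, let $g,\hat g:HK_{loc}(I)^m\to\mathcal A_D(I)$ be increasing with $g(x)\preceq\hat g(x)$ for all $x\in HK_{loc}(I)^m$, let $c,\hat c\in\mathbb R^m$ with $c_i\le\hat c_i$ for all $i$, and let $\underline y\le\overline y$ in $S_D$ be such that $\underline y$ is a subsolution of $(P_{g,c})$ and $\overline y$ is a supersolution of $(P_{\hat g,\hat c})$ (then both are a sub- and a supersolution, respectively, of both problems). If $y_*,\hat y_*$ are the smallest and $y^*,\hat y^*$ the greatest solutions of $(P_{g,c})$ and $(P_{\hat g,\hat c})$ in $[\underline y,\overline y]$,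 then $y_*\le\hat y_*$ and $y^*\le\hat y^*$ in $S_D$. -/

import Mathlib

open Set Filter Topology MeasureTheory
open scoped Distributions LineDeriv

namespace DistCauchy

/-! ### The interval `[0, b)`, `0 < b ≤ ∞`, and the Henstock--Kurzweil integral -/

/-- The half-open interval `[0, b)`, where `b` may be `∞`. -/
def Dom (b : EReal) : Set ℝ := {t | 0 ≤ t ∧ (t : EReal) < b}

/-- The point `0` of `[0, b)`. -/
instance (b : EReal) [hb : Fact (0 < b)] : Zero (Dom b) :=
  ⟨⟨0, le_refl 0, by simpa using hb.out⟩⟩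

/-- The interior `(0, b)` of `[0, b)`, as an open subset of the real line. -/
def DomInt (b : EReal) : TopologicalSpace.Opens ℝ :=
  ⟨{t | 0 < t ∧ (t : EReal) < b},
    isOpen_Ioi.inter (isOpen_Iio.preimage continuous_coe_real_ereal)⟩

/-- Extension by zero of a function on `[0, b)` to the real line; only its values on compact
subintervals of `[0, b)` are ever used. -/
noncomputable def ext0 {b : EReal} (f : Dom b → ℝ) : ℝ → ℝ :=
  Function.extend Subtype.val f 0

/-- `f` is Henstock--Kurzweil integrable on the compact interval `[s, t]`, `s < t`, with
integral `J`. -/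
def HasHKIntegral (f : ℝ → ℝ) (s t J : ℝ) : Prop :=
  ∃ h : s < t, BoxIntegral.HasIntegral
    (⟨fun _ => s, fun _ => t, fun _ => h⟩ : BoxIntegral.Box (Fin 1))
    BoxIntegral.IntegrationParams.Henstock (fun x => f (x 0))
    BoxIntegral.BoxAdditiveMap.volume J

/-- Local Henstock--Kurzweil integrability on `[0, b)`: integrability on every nondegenerate
compact subinterval. -/
def LocHK {b : EReal} (f : Dom b → ℝ) : Prop :=
  ∀ s t : Dom b, s < t → ∃ J, HasHKIntegral (ext0 f) s t J

/-- The filter of sets of full Lebesgue measure in `[0, b)`. -/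
noncomputable abbrev aeDom (b : EReal) : Filter (Dom b) := ae (Measure.comap (Subtype.val : Dom b → ℝ) volume)

/-- The space of locally Henstock--Kurzweil integrable functions on `[0, b)`, a.e. equal functions
being identified. It carries the a.e. pointwise partial order (inherited from germs along the
a.e. filter of Lebesgue measure on `[0, b)`). -/
abbrev HKloc (b : EReal) : Type :=
  {u : Filter.Germ (aeDom b) ℝ // ∃ f : Dom b → ℝ, LocHK f ∧ (f : Filter.Germ (aeDom b) ℝ) = u}

/-! ### Spaces of primitives -/

/-- The space `D^lr([0, b))`: locally Henstock--Kurzweil integrable functions with a left limit at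
every point of `(0, b)` and a right limit at `0`. -/
def IsDlr {b : EReal} [Fact (0 < b)] (H : Dom b → ℝ) : Prop :=
  LocHK H ∧ (∀ t : Dom b, 0 < t → ∃ l, Tendsto H (𝓝[<] t) (𝓝 l)) ∧
    ∃ l, Tendsto H (𝓝[>] 0) (𝓝 l)

/-- The space `D^lc([0, b))`: functions of `D^lr([0, b))` that are left continuous on `(0, b)` and
right continuous at `0`. -/
def IsDlc {b : EReal} [Fact (0 < b)] (H : Dom b → ℝ) : Prop :=
  IsDlr H ∧ (∀ t : Dom b, 0 < t → Tendsto H (𝓝[<] t) (𝓝 (H t))) ∧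
    Tendsto H (𝓝[>] 0) (𝓝 (H 0))

/-- The space `D^lc([0, b))`, ordered pointwise. -/
abbrev Dlc (b : EReal) [Fact (0 < b)] : Type := {H : Dom b → ℝ // IsDlc H}

/-- The subspace of those `F ∈ D^lc([0, b))` with `F(0+) = 0`. -/
abbrev Dlc0 (b : EReal) [Fact (0 < b)] : Type :=
  {F : Dlc b // Tendsto F.1 (𝓝[>] 0) (𝓝 0)}

/-- A function of `D^lc([0, b))` viewed as an element of the space of locally
Henstock--Kurzweil integrable functions. -/
noncomputable def Dlc.toHKloc {b : EReal} [Fact (0 < b)] (y : Dlc b) : HKloc b :=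
  ⟨(y.1 : Filter.Germ (aeDom b) ℝ), y.1, y.2.1.1, rfl⟩

/-! ### Distributions and their primitives -/

/-- Real distributions on `(0, b)`. -/
abbrev Distr (b : EReal) : Type := 𝓓'(DomInt b, ℝ)

/-- The distribution `T` is the one determined by the function `H`:
`⟨T, φ⟩ = ∫_s^t H φ` whenever `supp φ ⊆ [s, t] ⊆ [0, b)`. -/
def Represents {b : EReal} (H : Dom b → ℝ) (T : Distr b) : Prop :=
  ∀ (φ : 𝓓(DomInt b, ℝ)) (s t : Dom b), s < t → tsupport φ ⊆ Icc (s : ℝ) t →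
    HasHKIntegral (fun x => ext0 H x * φ x) s t (T φ)

/-- The distribution `f` is the distributional derivative of the function `H`:
`⟨f, φ⟩ = -∫_s^t H φ'` whenever `supp φ ⊆ [s, t] ⊆ [0, b)`. -/
def IsDistDeriv {b : EReal} (H : Dom b → ℝ) (f : Distr b) : Prop :=
  ∀ (φ : 𝓓(DomInt b, ℝ)) (s t : Dom b), s < t → tsupport φ ⊆ Icc (s : ℝ) t →
    HasHKIntegral (fun x => ext0 H x * deriv φ x) s t (-(f φ))

/-- The space `A_D([0, b))` of LDP integrable distributions: the distributional derivatives of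
functions of `D^lr([0, b))`. -/
def AD (b : EReal) [Fact (0 < b)] : Type :=
  {f : Distr b // ∃ H : Dom b → ℝ, IsDlr H ∧ IsDistDeriv H f}

/-- The order of `A_D([0, b))`: `f ⪯ g` iff `F ≤ G` pointwise, where `F`, `G` are the primitives
of `f`, `g` in the space of functions of `D^lc([0, b))` with right limit zero at `0`. -/
instance (b : EReal) [Fact (0 < b)] : LE (AD b) :=
  ⟨fun f g => ∃ F G : Dlc0 b, IsDistDeriv F.1.1 f.1 ∧ IsDistDeriv G.1.1 g.1 ∧ F ≤ G⟩

/-- `y' = z` in the sense of distributions, for functions `y`, `z` on `[0, b)`. -/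
def HasFunDeriv {b : EReal} (y z : Dom b → ℝ) : Prop :=
  ∃ T : Distr b, IsDistDeriv y T ∧ Represents z T

/-! ### The set `S_D` and the Cauchy problem of order `m ≥ 1` -/

/-- `Y = (y, y', …, y^(m-1))`: all components lie in `D^lc([0, b))` and each one is the
distributional derivative of the preceding one. -/
def IsDerivChain {b : EReal} [Fact (0 < b)] {m : ℕ} [NeZero m] (y : Dom b → ℝ)
    (Y : Fin m → Dlc b) : Prop :=
  (Y 0).1 = y ∧
    ∀ (i : ℕ) (h : i + 1 < m), HasFunDeriv (Y ⟨i, Nat.lt_of_succ_lt h⟩).1 (Y ⟨i + 1, h⟩).1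

/-- `S_D`: the functions `y : [0, b) → ℝ` with `y^(m-1) ∈ D^lc([0, b))`. (The derivatives of
order `< m - 1`, including `y`, are then the continuous primitives of the next ones.) -/
def SD (m : ℕ) [NeZero m] (b : EReal) [Fact (0 < b)] : Type :=
  {y : Dom b → ℝ // ∃ Y : Fin m → Dlc b, IsDerivChain y Y}

namespace SD

variable {m : ℕ} [NeZero m] {b : EReal} [Fact (0 < b)]

/-- The tuple `(y, y', …, y^(m-1))` of derivatives of `y ∈ S_D`. It is determined by `y`, since a
function of `D^lc([0, b))` is determined by the distribution it represents. -/
noncomputable def derivs (y : SD m b) : Fin m → Dlc b := Classical.choose y.2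

theorem derivs_spec (y : SD m b) : IsDerivChain y.1 y.derivs := Classical.choose_spec y.2

theorem derivs_injective : Function.Injective (derivs : SD m b → Fin m → Dlc b) := by
  intro y z h
  have hy := (derivs_spec y).1
  have hz := (derivs_spec z).1
  rw [h] at hy
  exact Subtype.ext (hy.symm.trans hz)

/-- `y ≤ z` iff `y^(i) ≤ z^(i)` pointwise on `[0, b)` for `i = 0, …, m - 1`. -/
noncomputable instance : PartialOrder (SD m b) := PartialOrder.lift derivs derivs_injective

/-- The highest function derivative `y^(m-1)`. -/
noncomputable def top (y : SD m b) : Dlc b :=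
  y.derivs ⟨m - 1, Nat.sub_one_lt (NeZero.ne m)⟩

/-- The tuple `(y, y', …, y^(m-1))` as an argument of the right-hand side. -/
noncomputable def jet (y : SD m b) : Fin m → HKloc b := fun i => (y.derivs i).toHKloc

end SD

section Problem

variable {m : ℕ} [NeZero m] {b : EReal} [Fact (0 < b)]

/-- `g` is increasing (componentwise a.e. order on the arguments, order of `A_D` on the values). -/
def IsIncreasing (g : (Fin m → HKloc b) → AD b) : Prop :=
  ∀ x z : Fin m → HKloc b, x ≤ z → g x ≤ g z

/-- `y` is a solution: `y^(m) = g(y, y', …, y^(m-1))` and `y^(i)(0) = c i`, `i = 0, …, m - 1`. -/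
def IsSolution (g : (Fin m → HKloc b) → AD b) (c : Fin m → ℝ) (y : SD m b) : Prop :=
  IsDistDeriv y.top.1 (g y.jet).1 ∧ ∀ i, (y.derivs i).1 0 = c i

/-- `y` is a subsolution: `y^(m) ⪯ g(y, y', …, y^(m-1))` and `y^(i)(0) ≤ c i`. -/
def IsSubsolution (g : (Fin m → HKloc b) → AD b) (c : Fin m → ℝ) (y : SD m b) : Prop :=
  (∃ f : AD b, IsDistDeriv y.top.1 f.1 ∧ f ≤ g y.jet) ∧ ∀ i, (y.derivs i).1 0 ≤ c i

/-- `y` is a supersolution: `g(y, y', …, y^(m-1)) ⪯ y^(m)` and `c i ≤ y^(i)(0)`. -/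
def IsSupersolution (g : (Fin m → HKloc b) → AD b) (c : Fin m → ℝ) (y : SD m b) : Prop :=
  (∃ f : AD b, IsDistDeriv y.top.1 f.1 ∧ g y.jet ≤ f) ∧ ∀ i, c i ≤ (y.derivs i).1 0

/-- The solutions lying in the order interval `[lo, hi]` of `S_D`. -/
def solutionsIn (g : (Fin m → HKloc b) → AD b) (c : Fin m → ℝ) (lo hi : SD m b) :
    Set (SD m b) :=
  {y | y ∈ Icc lo hi ∧ IsSolution g c y}

end Problem

end DistCauchy

/-!
The problem is turned into a fixed point problem for an increasing map, and solved by a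
Knaster–Tarski argument in the space of locally Henstock–Kurzweil integrable functions.

*The integral map.* A distribution of `A_D([0, b))` has a primitive in `D^lc([0, b))`, obtained from
any primitive by taking left limits (`AD.exists_primitive`). Integrating this primitive `m - 1`
times gives, for all initial values `c`, a function `SD.integrate c f` of `S_D` with `m`-th
derivative `f` (`SD.exists_of_deriv`). By the comparison principle `SD.le_of_deriv_le` it increases
with `c` and `f`. With `T x = SD.integrate c (g x)`, the solutions are the `y` with `T (jet y) = y`,
while `y ≤ T (jet y)` for subsolutions and `T (jet y) ≤ y` for supersolutions.

*Analysis behind it.* A function with left limits everywhere has countably many discontinuities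
(`countable_not_continuousAt_of_leftLimits`). Hence the indefinite integral of a function `z` of
`D^lc([0, b))`, which is continuous by the Saks–Henstock estimate, has derivative `z` off a
countable set, and the fundamental theorem with a countable exceptional set gives integration by
parts against test functions (`LocHK.represents_iff`). Uniqueness of primitives up to constants is
a Du Bois-Reymond lemma (`IsDlc.eq_zero_apply_of_isDistDeriv_zero`), where left continuity permits
to test with steep smooth steps. Together these show that `z` is the distributional derivative of
`y` if and only if `y(t) = y(0) + ∫_0^t z` (`IsDlc.hasFunDeriv_iff`).

*Completeness.* The Knaster–Tarski argument (`exists_least_fixedPoint_of_isGLB`) takes the infimum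
of the jets of all `y` in `[lo, hi]` with `T (jet y) ≤ y`. As these jets consist of functions with
countably many discontinuities, a countable subfamily has the same infimum almost everywhere
(`exists_countable_subfamily_forall_le`). This infimum is measurable and lies between `lo` and `hi`.
The difference `hi - lo` is nonnegative, so its Henstock–Kurzweil integrability is Lebesgue
integrability, and the infimum is again locally Henstock–Kurzweil integrable (`LocHK.of_between`).

The least fixed point is least even among all `y` in `[lo, hi]` with `T (jet y) ≤ y`; the
solutions of a problem with larger data are such points, whence the monotone dependence on the data.
-/

namespace DistCauchy

/-! ### The Henstock–Kurzweil integral on compact intervals -/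

namespace HasHKIntegral

variable {f g : ℝ → ℝ} {s t u J K : ℝ}

theorem lt (h : HasHKIntegral f s t J) : s < t := h.1

theorem unique (h : HasHKIntegral f s t J) (h' : HasHKIntegral f s t K) : J = K :=
  h.2.unique h'.2

theorem congr (h : HasHKIntegral f s t J) (hfg : ∀ x ∈ Icc s t, f x = g x) :
    HasHKIntegral g s t J := by
  refine ⟨h.1, (BoxIntegral.hasIntegral_congr _ _ (fun x hx => ?_) (fun _ _ => rfl) _).1 h.2⟩
  exact hfg _ ⟨hx.1 0, hx.2 0⟩

theorem add (hf : HasHKIntegral f s t J) (hg : HasHKIntegral g s t K) :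
    HasHKIntegral (fun x => f x + g x) s t (J + K) :=
  ⟨hf.1, hf.2.add hg.2⟩

theorem sub (hf : HasHKIntegral f s t J) (hg : HasHKIntegral g s t K) :
    HasHKIntegral (fun x => f x - g x) s t (J - K) :=
  ⟨hf.1, hf.2.sub hg.2⟩

theorem const_mul (c : ℝ) (hf : HasHKIntegral f s t J) :
    HasHKIntegral (fun x => c * f x) s t (c * J) :=
  ⟨hf.1, hf.2.smul c⟩

theorem nonneg (hf : HasHKIntegral f s t J) (h : ∀ x ∈ Icc s t, 0 ≤ f x) : 0 ≤ J := by
  rw [← hf.2.integral_eq]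
  exact BoxIntegral.integral_nonneg (g := fun x : Fin 1 → ℝ => f (x 0))
    (fun x hx => h _ ⟨hx.1 0, hx.2 0⟩) volume

theorem mono (hf : HasHKIntegral f s t J) (hg : HasHKIntegral g s t K)
    (h : ∀ x ∈ Icc s t, f x ≤ g x) : J ≤ K :=
  sub_nonneg.1 ((hg.sub hf).nonneg fun x hx => sub_nonneg.2 (h x hx))

end HasHKIntegral

/-- The one-dimensional box whose underlying set corresponds to `(s, t]`. -/
abbrev ivlBox {s t : ℝ} (h : s < t) : BoxIntegral.Box (Fin 1) :=
  ⟨fun _ => s, fun _ => t, fun _ => h⟩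

theorem coe_ivlBox {s t : ℝ} (h : s < t) :
    (ivlBox h : Set (Fin 1 → ℝ)) = MeasurableEquiv.funUnique (Fin 1) ℝ ⁻¹' Ioc s t := by
  ext x
  simp [BoxIntegral.Box.mem_coe, BoxIntegral.Box.mem_def]

theorem eq_ivlBox (B : BoxIntegral.Box (Fin 1)) : B = ivlBox (B.lower_lt_upper 0) := by
  ext x
  simp [BoxIntegral.Box.mem_def]

theorem ivlBox_le {s t p q : ℝ} {h : s < t} {h' : p < q} :
    ivlBox h' ≤ ivlBox h ↔ s ≤ p ∧ q ≤ t := by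
  rw [BoxIntegral.Box.le_iff_bounds]
  simp [Pi.le_def]

theorem volume_ivlBox {s t : ℝ} (h : s < t) (x : ℝ) :
    BoxIntegral.BoxAdditiveMap.volume (ivlBox h) x = (t - s) * x := by
  simp [BoxIntegral.BoxAdditiveMap.volume_apply]

namespace HasHKIntegral

variable {f g : ℝ → ℝ} {s t u J K : ℝ}

theorem congr_ae (h : HasHKIntegral f s t J) (hfg : f =ᵐ[volume.restrict (Ioc s t)] g) :
    HasHKIntegral g s t J := by
  refine ⟨h.1, h.2.congr_ae ?_ rfl⟩
  have hp := (volume_preserving_funUnique (Fin 1) ℝ).restrict_preimage (s := Ioc s t)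
    measurableSet_Ioc
  rw [← coe_ivlBox h.1] at hp
  exact hp.quasiMeasurePreserving.ae_eq_comp hfg

theorem of_integrableOn (h : s < t) (hf : IntegrableOn f (Ioc s t)) :
    HasHKIntegral f s t (∫ x in Ioc s t, f x) := by
  have hm := volume_preserving_funUnique (Fin 1) ℝ
  have he := (MeasurableEquiv.funUnique (Fin 1) ℝ).measurableEmbedding
  have h1 : IntegrableOn (fun x : Fin 1 → ℝ => f (x 0)) (ivlBox h) := by
    rw [coe_ivlBox]
    exact (hm.integrableOn_comp_preimage he).2 hf
  have h2 := h1.hasBoxIntegral BoxIntegral.IntegrationParams.Henstock rfl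
  refine ⟨h, ?_⟩
  have e : ∫ x in (ivlBox h : Set (Fin 1 → ℝ)), f (x 0) = ∫ x in Ioc s t, f x := by
    rw [coe_ivlBox]
    exact hm.setIntegral_preimage_emb he f (Ioc s t)
  rw [← e]
  exact h2

theorem subinterval {p q : ℝ} (h : HasHKIntegral f s t J) (hpq : p < q) (hp : s ≤ p) (hq : q ≤ t) :
    ∃ K, HasHKIntegral f p q K := by
  obtain ⟨K, hK⟩ := h.2.integrable.to_subbox (J := ivlBox hpq) (ivlBox_le.2 ⟨hp, hq⟩)
  exact ⟨K, hpq, hK⟩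

theorem of_adjacent {J₁ J₂ : ℝ} (h : HasHKIntegral f s u J) (h₁ : HasHKIntegral f s t J₁)
    (h₂ : HasHKIntegral f t u J₂) : J = J₁ + J₂ := by
  have hsplit := BoxIntegral.BoxAdditiveMap.map_split_add h.2.integrable.toBoxAdditive
    (I := ivlBox h.1) le_rfl 0 t
  rw [BoxIntegral.Box.splitLower_def (show t ∈ Ioo ((ivlBox h.1).lower 0) ((ivlBox h.1).upper 0)
      from ⟨h₁.1, h₂.1⟩),
    BoxIntegral.Box.splitUpper_def (show t ∈ Ioo ((ivlBox h.1).lower 0) ((ivlBox h.1).upper 0)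
      from ⟨h₁.1, h₂.1⟩)] at hsplit
  simp only [Function.update_eq_const_of_subsingleton] at hsplit
  have e1 := h.2.integral_eq
  have e2 := h₁.2.integral_eq
  have e3 := h₂.2.integral_eq
  rw [← e1, ← e2, ← e3]
  exact hsplit.symm

/-- **Saks–Henstock estimate** for one interval: the integral over a short interval `[p, q]`
containing `x` is close to `f x * (q - p)`. -/
theorem exists_small (h : HasHKIntegral f s t J) {x : ℝ} (hx : x ∈ Icc s t) {ε : ℝ} (hε : 0 < ε) :
    ∃ δ > 0, ∀ p q K, s ≤ p → q ≤ t → p ≤ x → x ≤ q → q - p ≤ δ → HasHKIntegral f p q K →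
      |(q - p) * f x - K| ≤ ε := by
  have hi := h.2.integrable
  refine ⟨(hi.convergenceR ε 0 fun _ => x : ℝ), (hi.convergenceR ε 0 fun _ => x).2, ?_⟩
  intro p q K hp hq hpx hxq hδ hK
  have hle : ivlBox hK.1 ≤ ivlBox h.1 := ivlBox_le.2 ⟨hp, hq⟩
  have hxI : (fun _ => x) ∈ BoxIntegral.Box.Icc (ivlBox h.1) := ⟨fun _ => hx.1, fun _ => hx.2⟩
  have hxJ : (fun _ => x) ∈ BoxIntegral.Box.Icc (ivlBox hK.1) := ⟨fun _ => hpx, fun _ => hxq⟩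
  have key := hi.dist_integralSum_sum_integral_le_of_memBaseSet (c := 0) hε
    (π := BoxIntegral.TaggedPrepartition.single _ _ hle _ hxI)
    ⟨?sub, fun _ => (BoxIntegral.TaggedPrepartition.isHenstock_single_iff _ _).2 hxJ,
      fun h => Bool.noConfusion h, fun h => Bool.noConfusion h⟩
  · have e := hK.2.integral_eq
    simp only [BoxIntegral.integralSum, BoxIntegral.TaggedPrepartition.single,
      BoxIntegral.Prepartition.single, Finset.sum_singleton, e, volume_ivlBox,
      Real.dist_eq] at key
    exact key
  · rw [BoxIntegral.TaggedPrepartition.isSubordinate_single]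
    intro y hy
    rw [Metric.mem_closedBall, dist_pi_le_iff (hi.convergenceR ε 0 fun _ => x).2.le]
    intro i
    have h1 : p ≤ y i := hy.1 i
    have h2 : y i ≤ q := hy.2 i
    rw [Real.dist_eq, abs_le]
    constructor <;> linarith

end HasHKIntegral

/-- The increment `F q - F p` over `(p, q]` as a box-additive function. -/
def incrementMap (F : ℝ → ℝ) (B : WithTop (BoxIntegral.Box (Fin 1))) :
    BoxIntegral.BoxAdditiveMap (Fin 1) ℝ B :=
  BoxIntegral.BoxAdditiveMap.ofMapSplitAdd (fun I => F (I.upper 0) - F (I.lower 0)) B (by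
    intro I _ i x hx
    obtain rfl : i = 0 := Subsingleton.elim _ _
    rw [BoxIntegral.Box.splitLower_def hx, BoxIntegral.Box.splitUpper_def hx]
    simp [Option.elim'])

/-- **Fundamental theorem of calculus** for the Henstock–Kurzweil integral, with a countable
exceptional set. -/
theorem hasHKIntegral_of_hasDerivAt {F f : ℝ → ℝ} {s t : ℝ} (h : s < t) {D : Set ℝ}
    (hD : D.Countable) (hc : ContinuousOn F (Icc s t))
    (hd : ∀ x ∈ Ioo s t, x ∉ D → HasDerivAt F (f x) x) :
    HasHKIntegral f s t (F t - F s) := by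
  refine ⟨h, ?_⟩
  have hD' : ((fun x : Fin 1 → ℝ => x 0) ⁻¹' (D ∪ {s, t})).Countable :=
    (hD.union (by simp)).preimage (MeasurableEquiv.funUnique (Fin 1) ℝ).injective
  refine BoxIntegral.HasIntegral.of_le_Henstock_of_forall_isLittleO (I := ivlBox h) le_rfl
    (incrementMap id _) ?_ (incrementMap F _) _ hD' ?_ ?_
  · exact fun B => sub_nonneg.2 (B.lower_le_upper 0)
  · intro _ x hx ε hε
    have hx0 : x 0 ∈ Icc s t := ⟨hx.1.1 0, hx.1.2 0⟩
    obtain ⟨δ, hδ, H⟩ := Metric.continuousWithinAt_iff.1 (hc _ hx0) (ε / 4) (by positivity)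
    have hM : 0 < |f (x 0)| + 1 := by positivity
    refine ⟨min (δ / 2) (ε / 4 / (|f (x 0)| + 1)), by positivity, fun B hB hBs hxB _ => ?_⟩
    obtain ⟨hp, hq⟩ : s ≤ B.lower 0 ∧ B.upper 0 ≤ t := by
      rw [eq_ivlBox B] at hB
      exact ivlBox_le.1 hB
    have hpq := B.lower_le_upper 0
    have h1 := dist_le_pi_dist B.lower x 0 |>.trans (hBs B.lower_mem_Icc)
    have h2 := dist_le_pi_dist B.upper x 0 |>.trans (hBs B.upper_mem_Icc)
    have hp' := H (x := B.lower 0) ⟨hp, hpq.trans hq⟩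
      ((h1.trans (min_le_left _ _)).trans_lt (by linarith))
    have hq' := H (x := B.upper 0) ⟨hp.trans hpq, hq⟩
      ((h2.trans (min_le_left _ _)).trans_lt (by linarith))
    have h1' := h1.trans (min_le_right _ _)
    have h2' := h2.trans (min_le_right _ _)
    rw [le_div_iff₀ hM] at h1' h2'
    rw [Real.dist_eq] at h1' h2' hp' hq'
    change dist (BoxIntegral.BoxAdditiveMap.volume B (f (x 0))) (F (B.upper 0) - F (B.lower 0)) ≤ ε
    rw [eq_ivlBox B, volume_ivlBox, Real.dist_eq]
    change |(B.upper 0 - B.lower 0) * f (x 0) - (F (B.upper 0) - F (B.lower 0))| ≤ ε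
    have e : (B.upper 0 - B.lower 0) * f (x 0) - (F (B.upper 0) - F (B.lower 0)) =
      ((B.upper 0 - x 0) * f (x 0) - (B.lower 0 - x 0) * f (x 0)) -
        ((F (B.upper 0) - F (x 0)) - (F (B.lower 0) - F (x 0))) := by ring
    have a1 : |(B.upper 0 - x 0) * f (x 0)| ≤ ε / 4 := by
      rw [abs_mul]; nlinarith [abs_nonneg (B.upper 0 - x 0)]
    have a2 : |(B.lower 0 - x 0) * f (x 0)| ≤ ε / 4 := by
      rw [abs_mul]; nlinarith [abs_nonneg (B.lower 0 - x 0)]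
    rw [e]
    rw [abs_le] at a1 a2 ⊢
    rw [abs_lt] at hp' hq'
    constructor <;> linarith
  · intro _ x hx ε hε
    have hxD : x 0 ∉ D := fun hh => hx.2 (Or.inl hh)
    have hxs : x 0 ≠ s := fun hh => hx.2 (Or.inr (Or.inl hh))
    have hxt : x 0 ≠ t := fun hh => hx.2 (Or.inr (Or.inr hh))
    have hx0 : x 0 ∈ Ioo s t := ⟨lt_of_le_of_ne (hx.1.1 0) hxs.symm, lt_of_le_of_ne (hx.1.2 0) hxt⟩
    obtain ⟨δ, hδ, H⟩ := Metric.eventually_nhds_iff.1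
      ((hasDerivAt_iff_isLittleO.1 (hd _ hx0 hxD)).def hε)
    refine ⟨δ / 2, by positivity, fun B hB hBs hxB _ => ?_⟩
    have h1 := dist_le_pi_dist B.lower x 0 |>.trans (hBs B.lower_mem_Icc)
    have h2 := dist_le_pi_dist B.upper x 0 |>.trans (hBs B.upper_mem_Icc)
    have h1' := H (h1.trans_lt (by linarith))
    have h2' := H (h2.trans_lt (by linarith))
    have b1 : B.lower 0 ≤ x 0 := hxB.1 0
    have b2 : x 0 ≤ B.upper 0 := hxB.2 0
    change dist (BoxIntegral.BoxAdditiveMap.volume B (f (x 0))) (F (B.upper 0) - F (B.lower 0)) ≤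
      ε * (B.upper 0 - B.lower 0)
    rw [eq_ivlBox B, volume_ivlBox, Real.dist_eq]
    change |(B.upper 0 - B.lower 0) * f (x 0) - (F (B.upper 0) - F (B.lower 0))| ≤ _
    simp only [Real.norm_eq_abs, smul_eq_mul] at h1' h2'
    rw [abs_of_nonpos (sub_nonpos.2 b1), abs_le] at h1'
    rw [abs_of_nonneg (sub_nonneg.2 b2), abs_le] at h2'
    rw [abs_le]
    constructor <;> nlinarith

/-- A nonnegative measurable Henstock–Kurzweil integrable function is Lebesgue integrable: its
truncations have Lebesgue integrals bounded by the Henstock–Kurzweil integral. -/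
theorem HasHKIntegral.integrableOn {f : ℝ → ℝ} {s t J : ℝ} (h : HasHKIntegral f s t J)
    (hm : AEMeasurable f (volume.restrict (Ioc s t))) (h0 : ∀ x ∈ Icc s t, 0 ≤ f x) :
    IntegrableOn f (Ioc s t) := by
  have hJ := h.nonneg h0
  have hnn : 0 ≤ᵐ[volume.restrict (Ioc s t)] f :=
    ae_restrict_of_forall_mem measurableSet_Ioc fun x hx => h0 x (Ioc_subset_Icc_self hx)
  -- Truncations are bounded and measurable, so that both integrals of them exist and agree.
  have hbound : ∀ n : ℕ, ∫⁻ x in Ioc s t, ENNReal.ofReal (min (f x) n) ≤ ENNReal.ofReal J := by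
    intro n
    have hi : IntegrableOn (fun x => min (f x) n) (Ioc s t) := by
      refine Integrable.of_bound (hm.min aemeasurable_const).aestronglyMeasurable n ?_
      filter_upwards [hnn] with x hx
      rw [Real.norm_eq_abs, abs_of_nonneg (le_min hx (Nat.cast_nonneg n))]
      exact min_le_right _ _
    rw [← ofReal_integral_eq_lintegral_ofReal hi
      (hnn.mono fun x hx => le_min hx (Nat.cast_nonneg n))]
    exact ENNReal.ofReal_le_ofReal
      ((HasHKIntegral.of_integrableOn h.1 hi).mono h fun x _ => min_le_left _ _)
  refine ⟨hm.aestronglyMeasurable, ?_⟩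
  rw [hasFiniteIntegral_iff_ofReal hnn]
  refine lt_of_le_of_lt ?_ (ENNReal.ofReal_lt_top (r := J))
  have hlim := lintegral_tendsto_of_tendsto_of_monotone (μ := volume.restrict (Ioc s t))
    (f := fun (n : ℕ) x => ENNReal.ofReal (min (f x) n)) (F := fun x => ENNReal.ofReal (f x))
    (fun n => (hm.min aemeasurable_const).ennreal_ofReal)
    (Eventually.of_forall fun x m n hmn => ENNReal.ofReal_le_ofReal
      (min_le_min le_rfl (Nat.cast_le.2 hmn)))
    (Eventually.of_forall fun x => by
      refine tendsto_const_nhds.congr' ?_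
      filter_upwards [eventually_ge_atTop ⌈f x⌉₊] with n hn
      rw [min_eq_left ((Nat.le_ceil _).trans (Nat.cast_le.2 hn))])
  exact le_of_tendsto' hlim hbound

/-! ### Functions with left limits -/

theorem eventually_eventually_nhds_of_nhdsWithin {α : Type*} [TopologicalSpace α] {s : Set α}
    (hs : IsOpen s) {a : α} {p : α → Prop} (h : ∀ᶠ x in 𝓝[s] a, p x) :
    ∀ᶠ y in 𝓝[s] a, ∀ᶠ x in 𝓝 y, p x := by
  filter_upwards [eventually_eventually_nhdsWithin.2 h, self_mem_nhdsWithin] with y hy hys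
  rwa [hs.nhdsWithin_eq hys] at hy

/-- A real function with left limits at all points has at most countably many discontinuities: the
points where its oscillation exceeds a given `ε > 0` are isolated from the left. -/
theorem countable_not_continuousAt_of_leftLimits {α : Type*} [LinearOrder α] [TopologicalSpace α]
    [OrderTopology α] [SecondCountableTopology α] {f : α → ℝ}
    (h : ∀ t, ∃ l, Tendsto f (𝓝[<] t) (𝓝 l)) : {x | ¬ContinuousAt f x}.Countable := by
  set D : ℕ → Set α := fun n => {x | ¬∃ l, ∀ᶠ y in 𝓝 x, |f y - l| < 1 / (n + 1 : ℝ)} with hD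
  have hsub : {x | ¬ContinuousAt f x} ⊆ ⋃ n, D n := by
    intro x hx
    by_contra hcon
    simp only [hD, mem_iUnion, mem_ofPred_eq, not_exists] at hcon
    refine hx (Metric.tendsto_nhds.2 fun ε hε => ?_)
    obtain ⟨n, hn⟩ := exists_nat_one_div_lt (half_pos hε)
    obtain ⟨l, hl⟩ := not_forall_not.1 (hcon n)
    have hx := hl.self_of_nhds
    filter_upwards [hl] with y hy
    rw [Real.dist_eq]
    rw [abs_lt] at hx hy ⊢
    constructor <;> linarith
  refine Countable.mono hsub (countable_iUnion fun n => ?_)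
  have hiso : D n ⊆ {x ∈ D n | 𝓝[D n ∩ Iio x] x = ⊥} := fun x hx => ⟨hx, ?_⟩
  · exact countable_setOfPred_isolated_left_within.mono hiso
  obtain ⟨l, hl⟩ := h x
  have h1 : ∀ᶠ y in 𝓝[<] x, |f y - l| < 1 / (n + 1 : ℝ) := by
    have := Metric.tendsto_nhds.1 hl (1 / (n + 1 : ℝ)) (by positivity)
    simpa only [Real.dist_eq] using this
  have h2 := eventually_eventually_nhds_of_nhdsWithin isOpen_Iio h1
  rw [inter_comm, nhdsWithin_inter', inf_principal_eq_bot]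
  filter_upwards [h2] with y hy hyD
  exact hyD ⟨l, hy⟩

/-- A function with countably many discontinuities is Borel measurable. -/
theorem measurable_of_countable_not_continuousAt {α : Type*} [TopologicalSpace α]
    [MeasurableSpace α] [BorelSpace α] [MeasurableSingletonClass α] {f : α → ℝ}
    (h : {x | ¬ContinuousAt f x}.Countable) : Measurable f := by
  refine measurable_of_isOpen fun U hU => ?_
  have e : f ⁻¹' U = interior (f ⁻¹' U) ∪ (f ⁻¹' U ∩ {x | ¬ContinuousAt f x}) := by
    refine Subset.antisymm (fun x hx => ?_) (union_subset interior_subset inter_subset_left)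
    by_cases hc : ContinuousAt f x
    · exact Or.inl (mem_interior_iff_mem_nhds.2 (hc (hU.mem_nhds hx)))
    · exact Or.inr ⟨hx, hc⟩
  rw [e]
  exact isOpen_interior.measurableSet.union (h.mono inter_subset_right).measurableSet

/-! ### The interval `[0, b)` -/

section Dom

variable {b : EReal}

instance : OrdConnected (Dom b) :=
  ⟨fun _ hx _ hy _ hz => ⟨hx.1.trans hz.1, lt_of_le_of_lt (EReal.coe_le_coe_iff.2 hz.2) hy.2⟩⟩

instance : NoMaxOrder (Dom b) :=
  ⟨fun x => by
    obtain ⟨c, hc, hcb⟩ := EReal.lt_iff_exists_real_btwn.1 x.2.2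
    exact ⟨⟨c, x.2.1.trans (EReal.coe_lt_coe_iff.1 hc).le, hcb⟩, EReal.coe_lt_coe_iff.1 hc⟩⟩

theorem measurableSet_Dom : MeasurableSet (Dom b) :=
  (inferInstance : OrdConnected (Dom b)).measurableSet

theorem mem_Dom_of_mem_Icc {s t : Dom b} {x : ℝ} (hx : x ∈ Icc (s : ℝ) t) : x ∈ Dom b :=
  (inferInstance : OrdConnected (Dom b)).out s.2 t.2 hx

theorem zero_le_Dom [Fact (0 < b)] (t : Dom b) : 0 ≤ t := t.2.1

@[simp] theorem coe_zero_Dom [Fact (0 < b)] : ((0 : Dom b) : ℝ) = 0 := rfl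

@[simp] theorem ext0_coe (f : Dom b → ℝ) (t : Dom b) : ext0 f t = f t :=
  Subtype.val_injective.extend_apply f 0 t

theorem ext0_of_mem (f : Dom b → ℝ) {x : ℝ} (hx : x ∈ Dom b) : ext0 f x = f ⟨x, hx⟩ :=
  ext0_coe f ⟨x, hx⟩

theorem domRestrict_ext0 (f : Dom b → ℝ) : (Dom b).domRestrict (ext0 f) = f :=
  funext fun t => ext0_coe f t

theorem continuousOn_ext0 {f : Dom b → ℝ} (hf : Continuous f) : ContinuousOn (ext0 f) (Dom b) := by
  rwa [continuousOn_iff_continuous_domRestrict, domRestrict_ext0]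

theorem continuousOn_ext0_Icc {f : Dom b → ℝ} (hf : Continuous f) (s t : Dom b) :
    ContinuousOn (ext0 f) (Icc s t) :=
  (continuousOn_ext0 hf).mono fun _ hx => mem_Dom_of_mem_Icc hx

theorem measurable_ext0 {f : Dom b → ℝ} (hf : Measurable f) : Measurable (ext0 f) :=
  (MeasurableEmbedding.subtype_coe measurableSet_Dom).measurable_extend hf measurable_zero

theorem Dom_mem_nhds [Fact (0 < b)] {t : Dom b} (ht : 0 < t) : Dom b ∈ 𝓝 (t : ℝ) := by
  filter_upwards [(DomInt b).2.mem_nhds (show (t : ℝ) ∈ DomInt b from ⟨ht, t.2.2⟩)] with x hx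
  exact ⟨hx.1.le, hx.2⟩

/-- A property of all points of `[0, b)` off a countable set holds almost everywhere on each
compact subinterval. -/
theorem ae_restrict_Ioc_of_countable {C : Set (Dom b)} (hC : C.Countable) (s t : Dom b)
    {p : ℝ → Prop} (h : ∀ x : Dom b, x ∉ C → p x) :
    ∀ᵐ x ∂volume.restrict (Ioc (s : ℝ) t), p x := by
  have h1 : ∀ᵐ x : ℝ, x ∉ Subtype.val '' C := (hC.image _).ae_notMem volume
  filter_upwards [ae_restrict_of_ae h1, ae_restrict_mem measurableSet_Ioc] with x hx hxs
  exact h ⟨x, mem_Dom_of_mem_Icc (Ioc_subset_Icc_self hxs)⟩ fun hh => hx ⟨_, hh, rfl⟩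

theorem ae_aeDom_of_countable {C : Set (Dom b)} (hC : C.Countable) {p : Dom b → Prop}
    (h : ∀ x, x ∉ C → p x) : ∀ᶠ x in aeDom b, p x := by
  have hC0 : Measure.comap (Subtype.val : Dom b → ℝ) volume C = 0 := by
    rw [(MeasurableEmbedding.subtype_coe measurableSet_Dom).comap_apply]
    exact (hC.image _).measure_zero _
  filter_upwards [measure_eq_zero_iff_ae_notMem.1 hC0] with x hx using h x hx

variable {H G : Dom b → ℝ}

theorem LocHK.of_continuous (h : Continuous H) : LocHK H := fun s t hst =>
  ⟨_, HasHKIntegral.of_integrableOn hst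
    ((continuousOn_ext0_Icc h s t).integrableOn_Icc.mono_set Ioc_subset_Icc_self)⟩

theorem LocHK.sub (hH : LocHK H) (hG : LocHK G) : LocHK (fun t => H t - G t) := by
  intro s t hst
  obtain ⟨J, hJ⟩ := hH s t hst
  obtain ⟨K, hK⟩ := hG s t hst
  refine ⟨J - K, (hJ.sub hK).congr fun x hx => ?_⟩
  simp [ext0_of_mem _ (mem_Dom_of_mem_Icc hx)]

theorem LocHK.add (hH : LocHK H) (hG : LocHK G) : LocHK (fun t => H t + G t) := by
  intro s t hst
  obtain ⟨J, hJ⟩ := hH s t hst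
  obtain ⟨K, hK⟩ := hG s t hst
  refine ⟨J + K, (hJ.add hK).congr fun x hx => ?_⟩
  simp [ext0_of_mem _ (mem_Dom_of_mem_Icc hx)]

end Dom

/-- Local integrability of a measurable function between two measurable ones: the difference to the
lower one is nonnegative, hence Lebesgue integrable. -/
theorem LocHK.of_between {b : EReal} {lo hi v : Dom b → ℝ} (hlo : LocHK lo) (hhi : LocHK hi)
    (mlo : Measurable lo) (mhi : Measurable hi) (mv : Measurable v)
    (h1 : ∀ t, lo t ≤ v t) (h2 : ∀ t, v t ≤ hi t) : LocHK v := by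
  intro s t hst
  obtain ⟨J, hJ⟩ := hhi.sub hlo s t hst
  have hint := hJ.integrableOn (measurable_ext0 (mhi.sub mlo)).aemeasurable fun x hx => by
    rw [ext0_of_mem _ (mem_Dom_of_mem_Icc hx)]
    exact sub_nonneg.2 ((h1 _).trans (h2 _))
  have hint2 : IntegrableOn (ext0 fun t => v t - lo t) (Ioc s t) := by
    refine Integrable.mono hint (measurable_ext0 (mv.sub mlo)).aestronglyMeasurable ?_
    refine ae_restrict_of_forall_mem measurableSet_Ioc fun x hx => ?_
    have hxD := mem_Dom_of_mem_Icc (Ioc_subset_Icc_self hx)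
    rw [ext0_of_mem _ hxD, ext0_of_mem _ hxD, Real.norm_eq_abs, Real.norm_eq_abs,
      abs_of_nonneg (sub_nonneg.2 (h1 _)), abs_of_nonneg (sub_nonneg.2 ((h1 _).trans (h2 _)))]
    exact sub_le_sub_right (h2 _) _
  obtain ⟨K, hK⟩ := hlo s t hst
  refine ⟨_, (hK.add (HasHKIntegral.of_integrableOn hst hint2)).congr fun x hx => ?_⟩
  simp [ext0_of_mem _ (mem_Dom_of_mem_Icc hx)]

section Dlc

variable {b : EReal} [Fact (0 < b)] {H G : Dom b → ℝ}

theorem IsDlr.countable_not_continuousAt (hH : IsDlr H) : {x | ¬ContinuousAt H x}.Countable := by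
  refine countable_not_continuousAt_of_leftLimits fun t => ?_
  rcases (zero_le_Dom t).eq_or_lt with rfl | ht
  · have e : Iio (0 : Dom b) = ∅ := eq_empty_of_forall_notMem fun x hx => (zero_le_Dom x).not_gt hx
    exact ⟨0, by simp [e]⟩
  · exact hH.2.1 t ht

theorem IsDlc.countable_not_continuousAt (hH : IsDlc H) : {x | ¬ContinuousAt H x}.Countable :=
  hH.1.countable_not_continuousAt

theorem IsDlc.measurable (hH : IsDlc H) : Measurable H :=
  measurable_of_countable_not_continuousAt hH.countable_not_continuousAt

theorem IsDlc.of_tendsto (h : LocHK H) (hl : ∀ t : Dom b, 0 < t → Tendsto H (𝓝[<] t) (𝓝 (H t)))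
    (h0 : Tendsto H (𝓝[>] 0) (𝓝 (H 0))) : IsDlc H :=
  ⟨⟨h, fun t ht => ⟨_, hl t ht⟩, _, h0⟩, hl, h0⟩

theorem IsDlc.of_continuous (h : Continuous H) : IsDlc H :=
  .of_tendsto (.of_continuous h) (fun _ _ => h.continuousAt.continuousWithinAt)
    h.continuousAt.continuousWithinAt

theorem IsDlc.sub (hH : IsDlc H) (hG : IsDlc G) : IsDlc (fun t => H t - G t) :=
  .of_tendsto (hH.1.1.sub hG.1.1) (fun t ht => (hH.2.1 t ht).sub (hG.2.1 t ht))
    (hH.2.2.sub hG.2.2)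

theorem IsDlc.add (hH : IsDlc H) (hG : IsDlc G) : IsDlc (fun t => H t + G t) :=
  .of_tendsto (hH.1.1.add hG.1.1) (fun t ht => (hH.2.1 t ht).add (hG.2.1 t ht))
    (hH.2.2.add hG.2.2)

theorem nhdsLT_neBot_of_pos {t : Dom b} (ht : 0 < t) : (𝓝[<] t).NeBot := by
  rw [← nhdsWithin_Ioo_eq_nhdsLT ht]
  exact right_nhdsWithin_Ioo_neBot ht

/-- Functions that are left continuous on `(0, b)` and right continuous at `0` and agree off a
countable set are equal. -/
theorem IsDlc.eq_of_countable (hH : IsDlc H) (hG : IsDlc G) {C : Set (Dom b)} (hC : C.Countable)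
    (h : ∀ x, x ∉ C → H x = G x) : H = G := by
  have hpos : ∀ t : Dom b, 0 < t → H t = G t := by
    intro t ht
    -- Left of `t` there are points off `C`, since nondegenerate intervals are uncountable.
    have hfreq : ∃ᶠ x in 𝓝[<] t, H x = G x := by
      intro hev
      obtain ⟨a, hat, ha⟩ := (mem_nhdsLT_iff_exists_Ioo_subset' ht).1 hev
      have hsub : Ioo a t ⊆ C := fun x hx => by
        by_contra hxC
        exact ha hx (h x hxC)
      have h2 : Ioo (a : ℝ) t ⊆ Subtype.val '' C := fun x hx =>
        ⟨⟨x, mem_Dom_of_mem_Icc (Ioo_subset_Icc_self hx)⟩, hsub ⟨hx.1, hx.2⟩, rfl⟩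
      have h3 := ((hC.image _).mono h2).measure_zero volume
      rw [Real.volume_Ioo, ENNReal.ofReal_eq_zero] at h3
      exact absurd (show (a : ℝ) < t from hat) (by linarith)
    have hl := (hH.2.1 t ht).sub (hG.2.1 t ht)
    by_contra hne
    have hne' : H t - G t ≠ 0 := sub_ne_zero.2 hne
    exact hfreq ((hl.eventually_ne hne').mono fun x hx hx' => hx (sub_eq_zero.2 hx'))
  funext t
  rcases (zero_le_Dom t).eq_or_lt with rfl | ht
  · refine tendsto_nhds_unique (hH.2.2.congr' ?_) hG.2.2
    filter_upwards [self_mem_nhdsWithin] with x hx using hpos x hx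
  · exact hpos t ht

end Dlc

/-! ### The indefinite Henstock–Kurzweil integral -/

section IndefiniteIntegral

variable {b : EReal} [Fact (0 < b)] {z w : Dom b → ℝ}

open Classical in
/-- The indefinite integral `t ↦ ∫_0^t z`; it has its meaning only for locally Henstock–Kurzweil
integrable `z`, and the value `0` otherwise and at `t = 0`. -/
noncomputable def primHK (z : Dom b → ℝ) (t : Dom b) : ℝ :=
  if h : ∃ J, HasHKIntegral (ext0 z) (0 : Dom b) t J then h.choose else 0

@[simp] theorem primHK_zero : primHK z 0 = 0 :=
  dif_neg fun ⟨_, h⟩ => lt_irrefl _ h.lt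

theorem LocHK.hasHKIntegral_primHK (hz : LocHK z) {t : Dom b} (ht : 0 < t) :
    HasHKIntegral (ext0 z) (0 : Dom b) t (primHK z t) := by
  have h := hz 0 t ht
  rw [primHK, dif_pos h]
  exact h.choose_spec

theorem LocHK.hasHKIntegral (hz : LocHK z) {s t : Dom b} (hst : s < t) :
    HasHKIntegral (ext0 z) s t (primHK z t - primHK z s) := by
  rcases (zero_le_Dom s).eq_or_lt with rfl | hs
  · simpa using hz.hasHKIntegral_primHK hst
  · obtain ⟨J, hJ⟩ := hz s t hst
    have := (hz.hasHKIntegral_primHK (hs.trans hst)).of_adjacent (hz.hasHKIntegral_primHK hs) hJ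
    rw [this]
    simpa using hJ

theorem LocHK.primHK_mono (hz : LocHK z) (hw : LocHK w) (h : ∀ t, z t ≤ w t) (t : Dom b) :
    primHK z t ≤ primHK w t := by
  rcases (zero_le_Dom t).eq_or_lt with rfl | ht
  · simp
  · refine (hz.hasHKIntegral_primHK ht).mono (hw.hasHKIntegral_primHK ht) fun x hx => ?_
    simp [ext0_of_mem _ (mem_Dom_of_mem_Icc hx), h]

theorem LocHK.continuous_primHK (hz : LocHK z) : Continuous (primHK z) := by
  refine Metric.continuous_iff.2 fun x ε hε => ?_
  obtain ⟨u, hu⟩ := exists_gt x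
  obtain ⟨δ, hδ, H⟩ := (hz.hasHKIntegral_primHK ((zero_le_Dom x).trans_lt hu)).exists_small
    (x := x) ⟨zero_le_Dom x, hu.le⟩ (half_pos hε)
  have hM : 0 < |z x| + 1 := by positivity
  have hux : (0 : ℝ) < u - x := sub_pos.2 hu
  refine ⟨min (min δ (u - x)) (ε / 2 / (|z x| + 1)), by positivity, fun y hy => ?_⟩
  rw [Subtype.dist_eq, lt_min_iff, lt_min_iff, lt_div_iff₀ hM] at hy
  obtain ⟨⟨hy1, hy2⟩, hy3⟩ := hy
  have hyu : (y : ℝ) ≤ u := by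
    rw [Real.dist_eq, abs_lt] at hy2
    linarith
  have hb : |(y - x : ℝ)| * |z x| < ε / 2 := by
    rw [Real.dist_eq] at hy3
    nlinarith [abs_nonneg ((y : ℝ) - x)]
  rw [Real.dist_eq] at hy1 ⊢
  rw [← abs_mul] at hb
  -- The Saks–Henstock estimate is used on the interval between `x` and `y`, with tag `x`.
  rcases lt_trichotomy y x with hyx | rfl | hyx
  · have h1 := H y x _ (zero_le_Dom y) (le_of_lt hu) (le_of_lt hyx) le_rfl
      ((neg_sub (y : ℝ) x ▸ neg_le_abs _).trans hy1.le) (hz.hasHKIntegral hyx)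
    rw [ext0_coe] at h1
    rw [abs_lt] at hb ⊢
    rw [abs_le] at h1
    constructor <;> linarith
  · simpa using hε
  · have h1 := H x y _ (zero_le_Dom x) hyu le_rfl (le_of_lt hyx)
      ((le_abs_self _).trans hy1.le) (hz.hasHKIntegral hyx)
    rw [ext0_coe] at h1
    rw [abs_lt] at hb ⊢
    rw [abs_le] at h1
    constructor <;> linarith

theorem hasHKIntegral_const {s t : ℝ} (h : s < t) (c : ℝ) :
    HasHKIntegral (fun _ => c) s t (c * (t - s)) := by
  have := hasHKIntegral_of_hasDerivAt (F := fun x => c * x) (f := fun _ => c) h countable_empty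
    (by fun_prop) fun x _ _ => by simpa using (hasDerivAt_id x).const_mul c
  rwa [mul_sub]

theorem LocHK.hasDerivAt_primHK (hz : LocHK z) {x : Dom b} (hx : 0 < x) (hc : ContinuousAt z x) :
    HasDerivAt (ext0 (primHK z)) (z x) x := by
  rw [hasDerivAt_iff_isLittleO, Asymptotics.isLittleO_iff]
  intro ε hε
  obtain ⟨δ, hδ, H⟩ := Metric.continuousAt_iff.1 hc ε hε
  filter_upwards [Dom_mem_nhds hx, Metric.ball_mem_nhds (x : ℝ) hδ] with y hyD hy
  lift y to Dom b using hyD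
  have key : ∀ u v : Dom b, u < v → dist u x < δ → dist v x < δ → u ≤ x → x ≤ v →
      |primHK z v - primHK z u - (v - u) * z x| ≤ ε * (v - u) := by
    intro u v huv hu hv hux hxv
    have h1 : ∀ p ∈ Icc (u : ℝ) v, |ext0 z p - z x| ≤ ε := by
      intro p hp
      rw [ext0_of_mem z (mem_Dom_of_mem_Icc hp), ← Real.dist_eq]
      refine (H ?_).le
      rw [Subtype.dist_eq, Real.dist_eq, abs_lt] at *
      change -δ < p - x ∧ p - x < δ
      constructor <;> linarith [hp.1, hp.2]
    have hI := hz.hasHKIntegral huv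
    have hl := (hasHKIntegral_const huv (z x - ε)).mono hI fun p hp => by
      linarith [(abs_le.1 (h1 p hp)).1]
    have hr := hI.mono (hasHKIntegral_const huv (z x + ε)) fun p hp => by
      linarith [(abs_le.1 (h1 p hp)).2]
    rw [abs_le]
    constructor <;> nlinarith
  rw [Metric.mem_ball] at hy
  simp only [ext0_coe, smul_eq_mul, Real.norm_eq_abs]
  rcases lt_trichotomy y x with hyx | rfl | hyx
  · have h1 := key y x hyx hy (by simpa using hδ) hyx.le le_rfl
    have hyx' : (y : ℝ) - x < 0 := sub_neg.2 hyx
    rw [abs_of_neg hyx', neg_sub]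
    rw [abs_le] at h1 ⊢
    constructor <;> linarith
  · simp
  · have h1 := key x y hyx (by simpa using hδ) hy le_rfl hyx.le
    have hyx' : 0 < (y : ℝ) - x := sub_pos.2 hyx
    rwa [abs_of_pos hyx']

end IndefiniteIntegral

/-! ### Distributional derivatives -/

section Distributions

variable {b : EReal}

theorem testFunction_differentiable (φ : 𝓓(DomInt b, ℝ)) : Differentiable ℝ φ :=
  φ.contDiff.differentiable (by simp)

theorem testFunction_continuous_deriv (φ : 𝓓(DomInt b, ℝ)) : Continuous (deriv φ) :=
  φ.contDiff.continuous_deriv (by simp)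

theorem eq_zero_left_of_tsupport_subset {φ : ℝ → ℝ} (hc : Continuous φ) {s t : ℝ}
    (h : tsupport φ ⊆ Icc s t) : φ s = 0 := by
  by_contra hne
  obtain ⟨x, hx, hxs⟩ := ((hc.continuousAt.eventually_ne hne).filter_mono
    (nhdsWithin_le_nhds (s := Iio s)) |>.and self_mem_nhdsWithin).exists
  exact absurd (h (subset_tsupport φ hx)).1 (not_le.2 hxs)

theorem eq_zero_right_of_tsupport_subset {φ : ℝ → ℝ} (hc : Continuous φ) {s t : ℝ}
    (h : tsupport φ ⊆ Icc s t) : φ t = 0 := by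
  by_contra hne
  obtain ⟨x, hx, hxs⟩ := ((hc.continuousAt.eventually_ne hne).filter_mono
    (nhdsWithin_le_nhds (s := Ioi t)) |>.and self_mem_nhdsWithin).exists
  exact absurd (h (subset_tsupport φ hx)).2 (not_le.2 hxs)

/-- The product of a function continuous on `[0, b)` and the derivative of a test function has a
Henstock–Kurzweil integral that is a Lebesgue integral. -/
theorem hasHKIntegral_mul_deriv {P : Dom b → ℝ} (hP : Continuous P) (φ : 𝓓(DomInt b, ℝ))
    {s t : Dom b} (hst : s < t) :
    HasHKIntegral (fun x => ext0 P x * deriv φ x) s t (∫ x in Ioc (s : ℝ) t, ext0 P x * deriv φ x) :=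
  .of_integrableOn hst (((continuousOn_ext0_Icc hP s t).mul
    (testFunction_continuous_deriv φ).continuousOn).integrableOn_Icc.mono_set Ioc_subset_Icc_self)

/-- A continuous function on `[0, b)` has a distributional derivative. -/
theorem exists_isDistDeriv_of_continuous {P : Dom b → ℝ} (hP : Continuous P) :
    ∃ T : Distr b, IsDistDeriv P T := by
  have hloc : LocallyIntegrableOn (ext0 P) (DomInt b) := by
    refine ContinuousOn.locallyIntegrableOn ((continuousOn_ext0 hP).mono fun x hx => ?_)
      (DomInt b).2.measurableSet
    exact ⟨hx.1.le, hx.2⟩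
  let S : 𝓓(DomInt b, ℝ) →L[ℝ] ℝ :=
    TestFunction.integralAgainstBilinCLM (ContinuousLinearMap.mul ℝ ℝ) volume (ext0 P)
  have hS : ∀ φ, S φ = ∫ x, φ x * ext0 P x := fun φ =>
    TestFunction.integralAgainstBilinCLM_eq_integral hloc
  let S' : 𝓓(DomInt b, ℝ) →L[ℝ] ℝ := -S.comp (TestFunction.lineDerivCLM ℝ (1 : ℝ))
  have hS' : ∀ φ, S' φ = -S (∂_{(1 : ℝ)} φ) := fun φ => rfl
  refine ⟨⟨S'.toLinearMap, S'.cont⟩, fun φ s t hst hsupp => ?_⟩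
  have h := hasHKIntegral_mul_deriv hP φ hst
  convert h using 1
  change -(S' φ) = _
  rw [hS', neg_neg, hS]
  have e : ∀ x, (∂_{(1 : ℝ)} φ : 𝓓(DomInt b, ℝ)) x = deriv φ x := by
    intro x
    rw [TestFunction.lineDerivOp_eq_lineDerivCLM ℝ, TestFunction.lineDerivCLM_apply_of_le (by simp)]
    rw [(testFunction_differentiable φ x).lineDeriv_eq_fderiv, fderiv_eq_smul_deriv, one_smul]
  have hsub : Function.support (fun x => ext0 P x * deriv φ x) ⊆ Icc (s : ℝ) t := by
    intro x hx
    refine hsupp (support_deriv_subset fun h0 => hx ?_)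
    simp [h0]
  rw [← integral_Icc_eq_integral_Ioc, setIntegral_eq_integral_of_forall_compl_eq_zero
    (fun x hx => by_contra fun h => hx (hsub h))]
  refine integral_congr_ae (Eventually.of_forall fun x => ?_)
  simp [e, mul_comm]

theorem IsDistDeriv.sub {G H : Dom b → ℝ} {S T : Distr b} (hG : IsDistDeriv G S)
    (hH : IsDistDeriv H T) : IsDistDeriv (fun t => G t - H t) (S - T) := by
  intro φ s t hst hφ
  have h := (hG φ s t hst hφ).sub (hH φ s t hst hφ)
  have e : -((S - T) φ) = -(S φ) - -(T φ) := by
    rw [sub_apply]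
    ring
  rw [e]
  refine h.congr fun x hx => ?_
  rw [ext0_of_mem _ (mem_Dom_of_mem_Icc hx), ext0_of_mem _ (mem_Dom_of_mem_Icc hx),
    ext0_of_mem _ (mem_Dom_of_mem_Icc hx), sub_mul]

/-- The distributional derivative does not change if a constant is added to the function and its
values are altered on a countable set. -/
theorem IsDistDeriv.congr_countable {G H : Dom b → ℝ} {T : Distr b} (hG : IsDistDeriv G T)
    {C : Set (Dom b)} (hC : C.Countable) (c : ℝ) (h : ∀ x, x ∉ C → H x = G x + c) :
    IsDistDeriv H T := by
  intro φ s t hst hφ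
  have hconst : HasHKIntegral (fun x => c * deriv φ x) s t (c * φ t - c * φ s) :=
    hasHKIntegral_of_hasDerivAt (F := fun x => c * φ x) hst countable_empty
      (φ.continuous.const_mul c |>.continuousOn)
      fun x _ _ => (testFunction_differentiable φ x).hasDerivAt.const_mul c
  rw [eq_zero_left_of_tsupport_subset φ.continuous hφ,
    eq_zero_right_of_tsupport_subset φ.continuous hφ] at hconst
  have h1 := (hG φ s t hst hφ).add hconst
  rw [mul_zero, sub_zero, add_zero] at h1
  refine h1.congr_ae (ae_restrict_Ioc_of_countable hC s t fun x hx => ?_)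
  simp only [ext0_coe, h x hx]
  ring

variable [Fact (0 < b)]

/-- **Integration by parts**: the distribution determined by a function with countably many
discontinuities is the distributional derivative of its indefinite integral. -/
theorem LocHK.represents_iff {z : Dom b → ℝ} (hz : LocHK z)
    (hc : {x | ¬ContinuousAt z x}.Countable) (T : Distr b) :
    Represents z T ↔ IsDistDeriv (primHK z) T := by
  have key : ∀ (φ : 𝓓(DomInt b, ℝ)) (s t : Dom b), s < t → tsupport φ ⊆ Icc (s : ℝ) t →
      HasHKIntegral (fun x => ext0 z x * φ x + ext0 (primHK z) x * deriv φ x) s t 0 := by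
    intro φ s t hst hφ
    have h := hasHKIntegral_of_hasDerivAt (F := fun x => ext0 (primHK z) x * φ x)
      (f := fun x => ext0 z x * φ x + ext0 (primHK z) x * deriv φ x) hst (hc.image Subtype.val)
      ((continuousOn_ext0_Icc hz.continuous_primHK s t).mul φ.continuous.continuousOn)
      fun x hx hxC => ?_
    · simpa [eq_zero_left_of_tsupport_subset φ.continuous hφ,
        eq_zero_right_of_tsupport_subset φ.continuous hφ] using h
    · have hxD := mem_Dom_of_mem_Icc (Ioo_subset_Icc_self hx)
      lift x to Dom b using hxD
      have hx0 : (0 : Dom b) < x := (zero_le_Dom s).trans_lt hx.1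
      have hcx : ContinuousAt z x := by_contra fun hh => hxC ⟨x, hh, rfl⟩
      rw [ext0_coe z]
      exact (hz.hasDerivAt_primHK hx0 hcx).mul (testFunction_differentiable φ x).hasDerivAt
  constructor
  · intro h φ s t hst hφ
    have := ((key φ s t hst hφ).sub (h φ s t hst hφ)).congr
      (g := fun x => ext0 (primHK z) x * deriv φ x) fun x _ => by ring
    rwa [zero_sub] at this
  · intro h φ s t hst hφ
    have := ((key φ s t hst hφ).sub (h φ s t hst hφ)).congr
      (g := fun x => ext0 z x * φ x) fun x _ => by ring
    rwa [zero_sub, neg_neg] at this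

theorem deriv_smoothTransition_of_nonpos {x : ℝ} (hx : x ≤ 0) : deriv Real.smoothTransition x = 0 :=
  IsLocalMin.deriv_eq_zero (Eventually.of_forall fun y => by
    rw [Real.smoothTransition.zero_of_nonpos hx]
    exact Real.smoothTransition.nonneg y)

theorem deriv_smoothTransition_of_one_le {x : ℝ} (hx : 1 ≤ x) : deriv Real.smoothTransition x = 0 :=
  IsLocalMax.deriv_eq_zero (Eventually.of_forall fun y => by
    rw [Real.smoothTransition.one_of_one_le hx]
    exact Real.smoothTransition.le_one y)

/-- The smooth step that rises from `0` to `1` on the interval `[p - δ, p]`. -/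
noncomputable def smoothStep (p δ x : ℝ) : ℝ := Real.smoothTransition ((x - (p - δ)) / δ)

section smoothStep

variable {p δ x : ℝ}

theorem contDiff_smoothStep {n : ℕ∞} : ContDiff ℝ n (smoothStep p δ) :=
  Real.smoothTransition.contDiff.comp (by fun_prop)

theorem smoothStep_of_le (hδ : 0 < δ) (hx : x ≤ p - δ) : smoothStep p δ x = 0 :=
  Real.smoothTransition.zero_of_nonpos (div_nonpos_of_nonpos_of_nonneg (by linarith) hδ.le)

theorem smoothStep_of_ge (hδ : 0 < δ) (hx : p ≤ x) : smoothStep p δ x = 1 :=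
  Real.smoothTransition.one_of_one_le ((one_le_div hδ).2 (by linarith))

theorem hasDerivAt_smoothStep : HasDerivAt (smoothStep p δ)
    (deriv Real.smoothTransition ((x - (p - δ)) / δ) * (1 / δ)) x := by
  have h1 : HasDerivAt (fun x : ℝ => (x - (p - δ)) / δ) (1 / δ) x :=
    ((hasDerivAt_id x).sub_const _).div_const δ
  exact ((Real.smoothTransition.contDiff (n := 1)).differentiable (by simp) _).hasDerivAt.comp x h1

theorem deriv_smoothStep_of_le (hδ : 0 < δ) (hx : x ≤ p - δ) : deriv (smoothStep p δ) x = 0 := by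
  rw [hasDerivAt_smoothStep.deriv, deriv_smoothTransition_of_nonpos, zero_mul]
  exact div_nonpos_of_nonpos_of_nonneg (by linarith) hδ.le

theorem deriv_smoothStep_of_ge (hδ : 0 < δ) (hx : p ≤ x) : deriv (smoothStep p δ) x = 0 := by
  rw [hasDerivAt_smoothStep.deriv, deriv_smoothTransition_of_one_le, zero_mul]
  exact (one_le_div hδ).2 (by linarith)

theorem deriv_smoothStep_nonneg (hδ : 0 < δ) : 0 ≤ deriv (smoothStep p δ) x := by
  rw [hasDerivAt_smoothStep.deriv]
  exact mul_nonneg Real.smoothTransition.monotone.deriv_nonneg (by positivity)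

/-- The average of `H` weighted by the derivative of a smooth step is close to `c` when `H` is. -/
theorem abs_sub_le_of_hasHKIntegral_mul_deriv_smoothStep {H : ℝ → ℝ} {c ε K : ℝ} (hδ : 0 < δ)
    (h : HasHKIntegral (fun x => H x * deriv (smoothStep p δ) x) (p - δ) p K)
    (hH : ∀ x ∈ Ioc (p - δ) p, |H x - c| ≤ ε) : |K - c| ≤ ε := by
  have h1 : HasHKIntegral (deriv (smoothStep p δ)) (p - δ) p 1 := by
    have := hasHKIntegral_of_hasDerivAt (F := smoothStep p δ) (sub_lt_self p hδ) countable_empty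
      (contDiff_smoothStep (n := 0)).continuous.continuousOn
      fun x _ _ => hasDerivAt_smoothStep.differentiableAt.hasDerivAt
    rwa [smoothStep_of_ge hδ le_rfl, smoothStep_of_le hδ le_rfl, sub_zero] at this
  have hx : ∀ x ∈ Icc (p - δ) p, |(H x - c) * deriv (smoothStep p δ) x| ≤
      ε * deriv (smoothStep p δ) x := by
    intro x hx
    rcases hx.1.eq_or_lt with hx1 | hx1
    · simp [deriv_smoothStep_of_le hδ hx1.ge]
    · rw [abs_mul, abs_of_nonneg (deriv_smoothStep_nonneg hδ)]
      exact mul_le_mul_of_nonneg_right (hH x ⟨hx1, hx.2⟩) (deriv_smoothStep_nonneg hδ)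
  have hl := (h1.const_mul (c - ε)).mono h fun x hxI => by linarith [(abs_le.1 (hx x hxI)).1]
  have hr := h.mono (h1.const_mul (c + ε)) fun x hxI => by linarith [(abs_le.1 (hx x hxI)).2]
  rw [abs_le]
  constructor <;> linarith

end smoothStep

/-- **Du Bois-Reymond lemma**: a function of `D^lc([0, b))` with zero distributional derivative is
constant. Testing with the difference of two steep smooth steps that rise just to the left of `p`
and of `q` shows that its values at `p` and `q` agree. -/
theorem IsDlc.eq_zero_apply_of_isDistDeriv_zero {H : Dom b → ℝ} (hH : IsDlc H)
    (h : IsDistDeriv H 0) (t : Dom b) : H t = H 0 := by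
  have hpos : ∀ p q : Dom b, 0 < p → p < q → H p = H q := by
    intro p q hp hpq
    by_contra hne
    have hε : 0 < |H p - H q| / 3 := by
      have := abs_pos.2 (sub_ne_zero.2 hne)
      positivity
    set ε := |H p - H q| / 3 with hεdef
    -- Left continuity at `r`, in terms of the extension to the real line.
    have hleft : ∀ r : Dom b, 0 < r → ∃ a : Dom b, a < r ∧
        ∀ x ∈ Ioc (a : ℝ) r, |ext0 H x - H r| ≤ ε := by
      intro r hr
      obtain ⟨a, har, ha⟩ := (mem_nhdsLT_iff_exists_Ioo_subset' hr).1
        (Metric.tendsto_nhds.1 (hH.2.1 r hr) ε hε)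
      refine ⟨a, har, fun x hx => ?_⟩
      have hxD := mem_Dom_of_mem_Icc (Ioc_subset_Icc_self hx)
      lift x to Dom b using hxD
      rw [ext0_coe]
      rcases hx.2.eq_or_lt with hxr | hxr
      · rw [Subtype.ext hxr]
        simpa using hε.le
      · exact (ha ⟨hx.1, hxr⟩ : dist (H x) (H r) < ε).le
    obtain ⟨a₁, ha₁, H₁⟩ := hleft p hp
    obtain ⟨a₂, ha₂, H₂⟩ := hleft q (hp.trans hpq)
    have hp' : (0 : ℝ) < p := hp
    have hpq' : (p : ℝ) < q := hpq
    have ha₁' : (a₁ : ℝ) < p := ha₁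
    have ha₂' : (a₂ : ℝ) < q := ha₂
    obtain ⟨δ, hδ, hδ'⟩ : ∃ δ > 0, δ < min (min ((p : ℝ) - a₁) (q - a₂)) (min p (q - p)) :=
      exists_between (by simp only [lt_min_iff, sub_pos]; exact ⟨⟨ha₁', ha₂'⟩, hp', hpq'⟩)
    simp only [lt_min_iff] at hδ'
    obtain ⟨⟨d1, d2⟩, d3, d4⟩ := hδ'
    set φ : ℝ → ℝ := fun x => smoothStep p δ x - smoothStep q δ x with hφ
    have hsupp : tsupport φ ⊆ Icc (p - δ) q := by
      refine closure_minimal (fun x hx => ?_) isClosed_Icc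
      by_contra hxI
      rw [mem_Icc, not_and_or, not_le, not_le] at hxI
      refine hx ?_
      rcases hxI with hx1 | hx1
      · simp only [hφ]
        rw [smoothStep_of_le hδ hx1.le, smoothStep_of_le hδ (by linarith), sub_zero]
      · simp only [hφ]
        rw [smoothStep_of_ge hδ (by linarith), smoothStep_of_ge hδ hx1.le, sub_self]
    have hφd : ∀ x, deriv φ x = deriv (smoothStep p δ) x - deriv (smoothStep q δ) x := fun x =>
      (hasDerivAt_smoothStep.differentiableAt.hasDerivAt.sub
        hasDerivAt_smoothStep.differentiableAt.hasDerivAt).deriv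
    have hs : (p : ℝ) - δ ∈ Dom b :=
      mem_Dom_of_mem_Icc (s := 0) (t := p) ⟨sub_nonneg.2 d3.le, (sub_lt_self _ hδ).le⟩
    have hint := h ⟨φ, contDiff_smoothStep.sub contDiff_smoothStep,
      HasCompactSupport.of_support_subset_isCompact isCompact_Icc
        ((subset_tsupport φ).trans hsupp), fun x hx => ⟨(sub_pos.2 d3).trans_le (hsupp hx).1,
          (EReal.coe_le_coe_iff.2 (hsupp hx).2).trans_lt q.2.2⟩⟩ ⟨p - δ, hs⟩ q
      (show (p : ℝ) - δ < q by linarith) hsupp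
    change HasHKIntegral (fun x => ext0 H x * deriv φ x) (p - δ) q (-0) at hint
    rw [neg_zero] at hint
    obtain ⟨K, hK⟩ := hint.subinterval (p := p) (q := q) hpq' (by linarith) le_rfl
    obtain ⟨K₁, hK₁⟩ := hint.subinterval (p := p - δ) (q := p) (by linarith) le_rfl (by linarith)
    obtain ⟨K₂, hK₂⟩ := hK.subinterval (p := p) (q := q - δ) (by linarith) le_rfl (by linarith)
    obtain ⟨K₃, hK₃⟩ := hK.subinterval (p := q - δ) (q := q) (by linarith) (by linarith) le_rfl
    have e1 := hint.of_adjacent hK₁ hK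
    have e2 := hK.of_adjacent hK₂ hK₃
    -- The test function is constant between the two steps.
    have e3 : K₂ = 0 := by
      refine hK₂.unique ((hasHKIntegral_const hK₂.lt 0).congr fun x hx => ?_ : HasHKIntegral _ _ _ _)
        |>.trans (zero_mul _)
      rw [hφd, deriv_smoothStep_of_ge hδ hx.1, deriv_smoothStep_of_le hδ hx.2]
      simp
    have b1 := abs_sub_le_of_hasHKIntegral_mul_deriv_smoothStep (c := H p) (ε := ε) hδ
      (hK₁.congr fun x hx => by
        rw [hφd, deriv_smoothStep_of_le (p := q) hδ (hx.2.trans (by linarith)), sub_zero])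
      fun x hx => H₁ x ⟨by linarith [hx.1], hx.2⟩
    have b3 := abs_sub_le_of_hasHKIntegral_mul_deriv_smoothStep (K := -K₃) (c := H q) (ε := ε) hδ
      (by
        have := (hK₃.const_mul (-1)).congr (g := fun x => ext0 H x * deriv (smoothStep q δ) x)
          fun x hx => by
            rw [hφd, deriv_smoothStep_of_ge (p := p) hδ (le_trans (by linarith) hx.1), zero_sub]
            ring
        rwa [neg_one_mul] at this)
      fun x hx => H₂ x ⟨by linarith [hx.1], hx.2⟩
    have e4 : K₁ = -K₃ := by linarith
    rw [e4] at b1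
    have h3 : |H p - H q| ≤ ε + ε := by
      calc |H p - H q| = |(-K₃ - H q) - (-K₃ - H p)| := by ring_nf
        _ ≤ |(-K₃ - H q)| + |(-K₃ - H p)| := abs_sub _ _
        _ ≤ ε + ε := add_le_add b3 b1
    linarith
  rcases (zero_le_Dom t).eq_or_lt with rfl | ht
  · rfl
  · refine tendsto_nhds_unique (tendsto_const_nhds.congr' ?_) hH.2.2
    filter_upwards [Ioo_mem_nhdsGT ht] with x hx using (hpos x t hx.1 hx.2).symm

/-- Two primitives in `D^lc([0, b))` of the same distribution differ by a constant. -/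
theorem IsDlc.sub_eq_of_isDistDeriv {G H : Dom b → ℝ} (hG : IsDlc G) (hH : IsDlc H) {T : Distr b}
    (h1 : IsDistDeriv G T) (h2 : IsDistDeriv H T) (t : Dom b) : G t - G 0 = H t - H 0 := by
  have h := h1.sub h2
  rw [sub_self] at h
  have := (hG.sub hH).eq_zero_apply_of_isDistDeriv_zero h t
  linarith

theorem IsDlc.hasFunDeriv_iff {y z : Dom b → ℝ} (hy : IsDlc y) (hz : IsDlc z) :
    HasFunDeriv y z ↔ ∀ t, y t = y 0 + primHK z t := by
  have hP : IsDlc (primHK z) := .of_continuous hz.1.1.continuous_primHK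
  constructor
  · rintro ⟨T, h1, h2⟩ t
    rw [hz.1.1.represents_iff hz.countable_not_continuousAt] at h2
    have := hy.sub_eq_of_isDistDeriv hP h1 h2 t
    rw [primHK_zero] at this
    linarith
  · intro h
    obtain ⟨T, hT⟩ := exists_isDistDeriv_of_continuous hz.1.1.continuous_primHK
    exact ⟨T, hT.congr_countable countable_empty (y 0) fun x _ => by rw [h x, add_comm],
      (hz.1.1.represents_iff hz.countable_not_continuousAt T).2 hT⟩

/-- A function of `D^lc([0, b))` is determined by its indefinite integral. -/
theorem IsDlc.eq_of_primHK_eq {z w : Dom b → ℝ} (hz : IsDlc z) (hw : IsDlc w)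
    (h : ∀ t, primHK z t = primHK w t) : z = w := by
  refine hz.eq_of_countable hw ((hz.countable_not_continuousAt.union
    hw.countable_not_continuousAt).union (countable_singleton 0)) fun x hx => ?_
  simp only [mem_union, mem_ofPred_eq, mem_singleton_iff, not_or, not_not] at hx
  have hx0 : 0 < x := lt_of_le_of_ne (zero_le_Dom x) (Ne.symm hx.2)
  have h1 := hz.1.1.hasDerivAt_primHK hx0 hx.1.1
  rw [funext h] at h1
  exact h1.unique (hw.1.1.hasDerivAt_primHK hx0 hx.1.2)

/-- A distribution of `A_D([0, b))` has a primitive in `D^lc([0, b))` with value `0` at `0`: the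
left limits of any primitive in `D^lr([0, b))`, up to a constant. -/
theorem AD.exists_primitive (f : AD b) : ∃ F : Dom b → ℝ, IsDlc F ∧ F 0 = 0 ∧ IsDistDeriv F f.1 := by
  obtain ⟨f, H, hH, hf⟩ := f
  obtain ⟨l₀, hl₀⟩ := hH.2.2
  choose! l hl using hH.2.1
  set F : Dom b → ℝ := fun t => if 0 < t then l t - l₀ else 0 with hF
  have hC : ({x | ¬ContinuousAt H x} ∪ {0}).Countable :=
    hH.countable_not_continuousAt.union (countable_singleton 0)
  have hFH : ∀ x, x ∉ {x | ¬ContinuousAt H x} ∪ {0} → F x = H x + -l₀ := by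
    intro x hx
    simp only [mem_union, mem_ofPred_eq, mem_singleton_iff, not_or, not_not] at hx
    have hx0 : 0 < x := lt_of_le_of_ne (zero_le_Dom x) (Ne.symm hx.2)
    have := nhdsLT_neBot_of_pos hx0
    simp only [hF, if_pos hx0]
    rw [tendsto_nhds_unique (hl x hx0) hx.1.continuousWithinAt, sub_eq_add_neg]
  have hlim : ∀ (s : Set (Dom b)) (a : Dom b) (c : ℝ), IsOpen s → (∀ x ∈ s, 0 < x) →
      Tendsto H (𝓝[s] a) (𝓝 c) → Tendsto F (𝓝[s] a) (𝓝 (c - l₀)) := by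
    intro s a c hs hs0 hc
    refine Metric.tendsto_nhds.2 fun ε hε => ?_
    have h1 : ∀ᶠ x in 𝓝[s] a, |H x - c| ≤ ε / 2 :=
      (Metric.tendsto_nhds.1 hc (ε / 2) (by positivity)).mono fun x hx => le_of_lt hx
    filter_upwards [eventually_eventually_nhds_of_nhdsWithin hs h1, self_mem_nhdsWithin]
      with y hy hys
    have := nhdsLT_neBot_of_pos (hs0 y hys)
    have h2 : |l y - c| ≤ ε / 2 := le_of_tendsto ((hl y (hs0 y hys)).sub_const c).abs
      (hy.filter_mono nhdsWithin_le_nhds)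
    simp only [hF, if_pos (hs0 y hys), Real.dist_eq, sub_sub_sub_cancel_right]
    linarith
  have hF0 : F 0 = 0 := by simp [hF]
  refine ⟨F, .of_tendsto ?_ ?_ ?_, hF0, hf.congr_countable hC _ hFH⟩
  · intro s t hst
    obtain ⟨J, hJ⟩ := hH.1 s t hst
    refine ⟨_, (hJ.add (hasHKIntegral_const hst (-l₀))).congr_ae
      (ae_restrict_Ioc_of_countable hC s t fun x hx => ?_)⟩
    simp only [ext0_coe, hFH x hx]
  · intro t ht
    have h1 := hl t ht
    rw [← nhdsWithin_Ioo_eq_nhdsLT ht] at h1 ⊢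
    have := hlim _ t _ isOpen_Ioo (fun x hx => hx.1) h1
    simpa only [hF, if_pos ht] using this
  · have := hlim _ 0 _ isOpen_Ioi (fun x hx => hx) hl₀
    rwa [sub_self, ← hF0] at this

end Distributions

/-! ### The order of the distributions and of the solution set -/

section Order

variable {b : EReal} [Fact (0 < b)]

theorem Dlc0.apply_zero (F : Dlc0 b) : F.1.1 0 = 0 := tendsto_nhds_unique F.1.2.2.2 F.2

theorem AD.le_refl (f : AD b) : f ≤ f := by
  obtain ⟨F, hF, hF0, hf⟩ := f.exists_primitive
  have h0 := hF.2.2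
  rw [hF0] at h0
  exact ⟨⟨⟨F, hF⟩, h0⟩, ⟨⟨F, hF⟩, h0⟩, hf, hf, le_rfl⟩

theorem AD.increment_le {f h : AD b} (hfh : f ≤ h) {G H : Dom b → ℝ} (hG : IsDlc G) (hH : IsDlc H)
    (h1 : IsDistDeriv G f.1) (h2 : IsDistDeriv H h.1) (t : Dom b) : G t - G 0 ≤ H t - H 0 := by
  obtain ⟨F₁, F₂, d1, d2, hle⟩ := hfh
  have e1 := hG.sub_eq_of_isDistDeriv F₁.1.2 h1 d1 t
  have e2 := hH.sub_eq_of_isDistDeriv F₂.1.2 h2 d2 t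
  rw [Dlc0.apply_zero] at e1 e2
  have : F₁.1.1 t ≤ F₂.1.1 t := hle t
  linarith

variable {m : ℕ} [NeZero m]

theorem IsDerivChain.unique {y : Dom b → ℝ} {Y Z : Fin m → Dlc b} (hY : IsDerivChain y Y)
    (hZ : IsDerivChain y Z) : Y = Z := by
  have h : ∀ (i : ℕ) (hi : i < m), Y ⟨i, hi⟩ = Z ⟨i, hi⟩ := by
    intro i
    induction i with
    | zero => exact fun _ => Subtype.ext (hY.1.trans hZ.1.symm)
    | succ i ih =>
      intro hi
      have h1 := ((Y _).2.hasFunDeriv_iff (Y _).2).1 (hY.2 i hi)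
      have h2 := ((Z _).2.hasFunDeriv_iff (Z _).2).1 (hZ.2 i hi)
      rw [ih (Nat.lt_of_succ_lt hi)] at h1
      exact Subtype.ext ((Y _).2.eq_of_primHK_eq (Z _).2 fun t =>
        add_left_cancel ((h1 t).symm.trans (h2 t)))
  exact funext fun i => h i.1 i.2

namespace SD

theorem derivs_mk {y : Dom b → ℝ} {Y : Fin m → Dlc b} (h : IsDerivChain y Y) :
    derivs ⟨y, Y, h⟩ = Y :=
  IsDerivChain.unique (derivs_spec _) h

theorem le_iff {y z : SD m b} : y ≤ z ↔ ∀ i t, (y.derivs i).1 t ≤ (z.derivs i).1 t := Iff.rfl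

theorem derivs_apply_eq (y : SD m b) (i : ℕ) (hi : i + 1 < m) (t : Dom b) :
    (y.derivs ⟨i, Nat.lt_of_succ_lt hi⟩).1 t =
      (y.derivs ⟨i, Nat.lt_of_succ_lt hi⟩).1 0 + primHK (y.derivs ⟨i + 1, hi⟩).1 t :=
  ((y.derivs _).2.hasFunDeriv_iff (y.derivs _).2).1 ((derivs_spec y).2 i hi) t

/-- The comparison principle: inequalities between the highest distributional derivatives and the
initial values integrate to an inequality in `S_D`. -/
theorem le_of_deriv_le {y z : SD m b} {f h : AD b} (hy : IsDistDeriv y.top.1 f.1)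
    (hz : IsDistDeriv z.top.1 h.1) (hfh : f ≤ h)
    (h0 : ∀ i, (y.derivs i).1 0 ≤ (z.derivs i).1 0) : y ≤ z := by
  have key : ∀ (n i : ℕ) (hi : i < m), i + n = m - 1 →
      ∀ t, (y.derivs ⟨i, hi⟩).1 t ≤ (z.derivs ⟨i, hi⟩).1 t := by
    intro n
    induction n with
    | zero =>
      intro i hi hin t
      obtain rfl : i = m - 1 := hin
      have h1 := AD.increment_le hfh y.top.2 z.top.2 hy hz t
      have h2 := h0 ⟨m - 1, hi⟩
      change y.top.1 t ≤ z.top.1 t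
      change y.top.1 0 ≤ z.top.1 0 at h2
      linarith
    | succ n ih =>
      intro i hi hin t
      have hi1 : i + 1 < m := by omega
      rw [derivs_apply_eq y i hi1, derivs_apply_eq z i hi1]
      exact add_le_add (h0 _) ((y.derivs _).2.1.1.primHK_mono (z.derivs _).2.1.1
        (ih (i + 1) hi1 (by omega)) t)
  exact le_iff.2 fun i t => key (m - 1 - i) i i.2 (by omega) t

/-- Repeated integration: every distribution of `A_D([0, b))` is the `m`-th derivative of a function
of `S_D` with prescribed initial values. -/
theorem exists_of_deriv (f : AD b) (c : Fin m → ℝ) :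
    ∃ y : SD m b, IsDistDeriv y.top.1 f.1 ∧ ∀ i, (y.derivs i).1 0 = c i := by
  obtain ⟨F, hF, hF0, hf⟩ := f.exists_primitive
  let c' : ℕ → ℝ := fun i => if hi : i < m then c ⟨i, hi⟩ else 0
  -- The derivative of order `m - 1 - k`.
  let Z : ℕ → Dom b → ℝ := fun k =>
    Nat.rec (fun t => F t + c' (m - 1)) (fun k z t => primHK z t + c' (m - 1 - (k + 1))) k
  have hZ : ∀ k, IsDlc (Z k) := by
    intro k
    induction k with
    | zero => exact hF.add (.of_continuous continuous_const)
    | succ k ih => exact .of_continuous (ih.1.1.continuous_primHK.add continuous_const)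
  have hZ0 : ∀ k, Z k 0 = c' (m - 1 - k) := by
    rintro (_ | k)
    · change F 0 + c' (m - 1) = _
      rw [hF0, zero_add, Nat.sub_zero]
    · change primHK (Z k) 0 + c' (m - 1 - (k + 1)) = _
      rw [primHK_zero, zero_add]
  let Y : Fin m → Dlc b := fun i => ⟨Z (m - 1 - i), hZ _⟩
  have hY : IsDerivChain (Y 0).1 Y := by
    refine ⟨rfl, fun i hi => ((hZ _).hasFunDeriv_iff (hZ _)).2 fun t => ?_⟩
    have e : m - 1 - i = m - 1 - (i + 1) + 1 := by omega
    have h1 : ∀ t, Z (m - 1 - i) t =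
        primHK (Z (m - 1 - (i + 1))) t + c' (m - 1 - (m - 1 - (i + 1) + 1)) := by
      rw [e]
      exact fun _ => rfl
    change Z (m - 1 - i) t = Z (m - 1 - i) 0 + primHK (Z (m - 1 - (i + 1))) t
    rw [h1 t, h1 0, primHK_zero, zero_add, add_comm]
  refine ⟨⟨_, Y, hY⟩, ?_, fun i => ?_⟩
  · have e : (top ⟨_, Y, hY⟩).1 = Z 0 := by
      change (derivs ⟨_, Y, hY⟩ ⟨m - 1, _⟩).1 = Z 0
      rw [derivs_mk hY]
      change Z (m - 1 - (m - 1)) = Z 0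
      rw [Nat.sub_self]
    rw [e]
    exact hf.congr_countable countable_empty (c' (m - 1)) fun _ _ => rfl
  · rw [derivs_mk hY]
    change Z (m - 1 - i) 0 = c i
    rw [hZ0, show m - 1 - (m - 1 - i) = (i : ℕ) by omega]
    exact dif_pos i.2

theorem jet_mono : Monotone (jet : SD m b → Fin m → HKloc b) := fun _ _ h i =>
  Filter.Germ.coe_le.2 (Eventually.of_forall (h i))

end SD

end Order

/-! ### Infima and suprema in the space of locally integrable functions -/

section Completeness

/-- A family of functions with countably many discontinuities each has a countable subfamily whose
pointwise infimum lies below each member of the family off a countable set. By the Lindelöf property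
countably many of the interiors of the sets `{y < r}` suffice to cover all of them; this is done for
every `r` in a countable dense set. -/
theorem exists_countable_subfamily_forall_le {α β : Type*} [TopologicalSpace α]
    [SecondCountableTopology α] [LinearOrder β] [TopologicalSpace β] [OrderTopology β]
    [SecondCountableTopology β] [DenselyOrdered β] (A : Set (α → β)) :
    ∃ B ⊆ A, B.Countable ∧ ∀ y ∈ A, ∀ x, ContinuousAt y x →
      ∀ v, (∀ w ∈ B, v ≤ w x) → v ≤ y x := by
  obtain ⟨Q, hQc, hQd⟩ := TopologicalSpace.exists_countable_dense β
  have hB : ∀ r : β, ∃ B ⊆ A, B.Countable ∧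
      ⋃ y ∈ B, interior {x | y x < r} = ⋃ y ∈ A, interior {x | y x < r} := fun r => by
    obtain ⟨B, h1, h2, h3⟩ := TopologicalSpace.isOpen_biUnion_countable A
      (fun y : α → β => interior {x | y x < r}) fun _ _ => isOpen_interior
    exact ⟨B, h1, h2, h3⟩
  choose B hBA hBc hBU using hB
  refine ⟨⋃ r ∈ Q, B r, iUnion₂_subset fun r _ => hBA r, hQc.biUnion fun r _ => hBc r, ?_⟩
  intro y hy x hx v hv
  by_contra! hlt
  obtain ⟨r, hr, hyr, hrv⟩ := hQd.exists_between hlt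
  have hmem : x ∈ ⋃ y ∈ A, interior {x | y x < r} :=
    mem_biUnion hy (mem_interior_iff_mem_nhds.2 (hx.eventually_lt_const hyr))
  rw [← hBU r, mem_iUnion₂] at hmem
  obtain ⟨w, hw, hxw⟩ := hmem
  have hwr : x ∈ {x | w x < r} := interior_subset hxw
  exact (hv w (mem_biUnion hr hw)).not_gt (lt_trans hwr hrv)

variable {b : EReal} [Fact (0 < b)]

/-- Order bounded sets of functions of `D^lc([0, b))` have an infimum in the space of locally
Henstock–Kurzweil integrable functions, the class of a countable pointwise infimum. -/
theorem exists_isGLB_toHKloc {A : Set (Dlc b)} (hA : A.Nonempty) {lo hi : Dlc b}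
    (hAlh : A ⊆ Icc lo hi) : ∃ x, IsGLB (Dlc.toHKloc '' A) x := by
  obtain ⟨B₀, hB₀A, hB₀c, hB₀⟩ :=
    exists_countable_subfamily_forall_le (Subtype.val '' A : Set (Dom b → ℝ))
  obtain ⟨y₀, hy₀⟩ := hA
  set B := insert y₀.1 B₀ with hBdef
  have hBc : B.Countable := hB₀c.insert _
  have hBA : ∀ w ∈ B, ∃ y ∈ A, y.1 = w := by
    rintro w (rfl | hw)
    exacts [⟨y₀, hy₀, rfl⟩, hB₀A hw]
  have : Countable B := hBc
  have : Nonempty B := ⟨⟨y₀.1, Or.inl rfl⟩⟩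
  set v : Dom b → ℝ := fun t => ⨅ w : B, w.1 t with hv
  have hlo : ∀ (w : B) t, lo.1 t ≤ w.1 t := fun w t => by
    obtain ⟨y, hy, hyw⟩ := hBA w.1 w.2
    rw [← hyw]
    exact (hAlh hy).1 t
  have hbdd : ∀ t, BddBelow (range fun w : B => w.1 t) := fun t =>
    ⟨lo.1 t, forall_mem_range.2 fun w => hlo w t⟩
  have hvB : ∀ w ∈ B, ∀ t, v t ≤ w t := fun w hw t => ciInf_le (hbdd t) (⟨w, hw⟩ : B)
  have hvm : Measurable v := Measurable.iInf fun w => by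
    obtain ⟨y, _, hyw⟩ := hBA w.1 w.2
    rw [← hyw]
    exact y.2.measurable
  have hvHK : LocHK v := .of_between lo.2.1.1 hi.2.1.1 lo.2.measurable hi.2.measurable hvm
    (fun t => le_ciInf fun w => hlo w t)
    fun t => (hvB y₀.1 (Or.inl rfl) t).trans ((hAlh hy₀).2 t)
  refine ⟨⟨(v : Filter.Germ (aeDom b) ℝ), v, hvHK, rfl⟩, ?_, ?_⟩
  · rintro _ ⟨y, hy, rfl⟩
    refine Filter.Germ.coe_le.2
      (ae_aeDom_of_countable y.2.countable_not_continuousAt fun t ht => ?_)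
    exact hB₀ y.1 ⟨y, hy, rfl⟩ t (not_not.1 ht) _ fun w hw => hvB w (Or.inr hw) t
  · rintro ⟨_, u, _, rfl⟩ hu
    refine Filter.Germ.coe_le.2 ?_
    have hall : ∀ᶠ t in aeDom b, ∀ w ∈ B, u t ≤ w t := by
      refine (eventually_countable_ball hBc).2 fun w hw => ?_
      obtain ⟨y, hy, rfl⟩ := hBA w hw
      exact Filter.Germ.coe_le.1 (hu ⟨y, hy, rfl⟩)
    exact hall.mono fun t ht => le_ciInf fun w => ht w.1 w.2

/-- Order bounded sets of functions of `D^lc([0, b))` have a supremum in the space of locally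
Henstock–Kurzweil integrable functions, the class of a countable pointwise supremum. -/
theorem exists_isLUB_toHKloc {A : Set (Dlc b)} (hA : A.Nonempty) {lo hi : Dlc b}
    (hAlh : A ⊆ Icc lo hi) : ∃ x, IsLUB (Dlc.toHKloc '' A) x := by
  obtain ⟨B₀, hB₀A, hB₀c, hB₀⟩ := exists_countable_subfamily_forall_le (β := ℝᵒᵈ)
    (Subtype.val '' A : Set (Dom b → ℝ))
  obtain ⟨y₀, hy₀⟩ := hA
  set B : Set (Dom b → ℝ) := insert y₀.1 B₀ with hBdef
  have hBc : B.Countable := hB₀c.insert _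
  have hBA : ∀ w ∈ B, ∃ y ∈ A, y.1 = w := by
    rintro w (rfl | hw)
    exacts [⟨y₀, hy₀, rfl⟩, hB₀A hw]
  have : Countable B := hBc
  have : Nonempty B := ⟨⟨y₀.1, Or.inl rfl⟩⟩
  set v : Dom b → ℝ := fun t => ⨆ w : B, w.1 t with hv
  have hhi : ∀ (w : B) t, w.1 t ≤ hi.1 t := fun w t => by
    obtain ⟨y, hy, hyw⟩ := hBA w.1 w.2
    rw [← hyw]
    exact (hAlh hy).2 t
  have hbdd : ∀ t, BddAbove (range fun w : B => w.1 t) := fun t =>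
    ⟨hi.1 t, forall_mem_range.2 fun w => hhi w t⟩
  have hvB : ∀ w ∈ B, ∀ t, w t ≤ v t := fun w hw t => le_ciSup (hbdd t) (⟨w, hw⟩ : B)
  have hvm : Measurable v := Measurable.iSup fun w => by
    obtain ⟨y, _, hyw⟩ := hBA w.1 w.2
    rw [← hyw]
    exact y.2.measurable
  have hvHK : LocHK v := .of_between lo.2.1.1 hi.2.1.1 lo.2.measurable hi.2.measurable hvm
    (fun t => ((hAlh hy₀).1 t).trans (hvB y₀.1 (Or.inl rfl) t))
    fun t => ciSup_le fun w => hhi w t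
  refine ⟨⟨(v : Filter.Germ (aeDom b) ℝ), v, hvHK, rfl⟩, ?_, ?_⟩
  · rintro _ ⟨y, hy, rfl⟩
    refine Filter.Germ.coe_le.2
      (ae_aeDom_of_countable y.2.countable_not_continuousAt fun t ht => ?_)
    exact hB₀ y.1 ⟨y, hy, rfl⟩ t (not_not.1 ht) (v t) fun w hw => hvB w (Or.inr hw) t
  · rintro ⟨_, u, _, rfl⟩ hu
    refine Filter.Germ.coe_le.2 ?_
    have hall : ∀ᶠ t in aeDom b, ∀ w ∈ B, w t ≤ u t := by
      refine (eventually_countable_ball hBc).2 fun w hw => ?_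
      obtain ⟨y, hy, rfl⟩ := hBA w hw
      exact Filter.Germ.coe_le.1 (hu ⟨y, hy, rfl⟩)
    exact hall.mono fun t ht => ciSup_le fun w => ht w.1 w.2

variable {m : ℕ} [NeZero m] {A : Set (SD m b)} {lo hi : SD m b}

theorem SD.eval_image_jet (A : Set (SD m b)) (i : Fin m) :
    Function.eval i '' (SD.jet '' A) = Dlc.toHKloc '' ((fun y => y.derivs i) '' A) := by
  rw [image_image, image_image]
  rfl

theorem SD.exists_isGLB_jet (hA : A.Nonempty) (hAlh : A ⊆ Icc lo hi) :
    ∃ x, IsGLB (SD.jet '' A) x := by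
  have h : ∀ i, ∃ x, IsGLB (Function.eval i '' (SD.jet '' A)) x := fun i => by
    rw [SD.eval_image_jet]
    refine exists_isGLB_toHKloc (hA.image _) (lo := lo.derivs i) (hi := hi.derivs i) ?_
    rintro _ ⟨y, hy, rfl⟩
    exact ⟨(hAlh hy).1 i, (hAlh hy).2 i⟩
  choose x hx using h
  exact ⟨x, isGLB_pi.2 hx⟩

theorem SD.exists_isLUB_jet (hA : A.Nonempty) (hAlh : A ⊆ Icc lo hi) :
    ∃ x, IsLUB (SD.jet '' A) x := by
  have h : ∀ i, ∃ x, IsLUB (Function.eval i '' (SD.jet '' A)) x := fun i => by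
    rw [SD.eval_image_jet]
    refine exists_isLUB_toHKloc (hA.image _) (lo := lo.derivs i) (hi := hi.derivs i) ?_
    rintro _ ⟨y, hy, rfl⟩
    exact ⟨(hAlh hy).1 i, (hAlh hy).2 i⟩
  choose x hx using h
  exact ⟨x, isLUB_pi.2 hx⟩

end Completeness

/-! ### Fixed points -/

/-- A **Knaster–Tarski** argument: for increasing maps `J : S → X` and `T : X → S` between ordered
sets, where only the images under `J` of subsets of `[lo, hi]` need infima, the map `T ∘ J` has a
fixed point in `[lo, hi]` that is the least one of the points of `[lo, hi]` mapped below
themselves. -/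
theorem exists_least_fixedPoint_of_isGLB {S X : Type*} [PartialOrder S] [Preorder X] {J : S → X}
    {T : X → S} (hJ : Monotone J) (hT : Monotone T) {lo hi : S} (hlohi : lo ≤ hi)
    (hlo : lo ≤ T (J lo)) (hhi : T (J hi) ≤ hi)
    (hglb : ∀ A : Set S, A.Nonempty → A ⊆ Icc lo hi → ∃ x, IsGLB (J '' A) x) :
    ∃ y ∈ Icc lo hi, T (J y) = y ∧ ∀ z ∈ Icc lo hi, T (J z) ≤ z → y ≤ z := by
  set A := {z ∈ Icc lo hi | T (J z) ≤ z} with hA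
  have hhiA : hi ∈ A := ⟨⟨hlohi, le_rfl⟩, hhi⟩
  obtain ⟨x, hx⟩ := hglb A ⟨hi, hhiA⟩ fun z hz => hz.1
  have hle : ∀ z ∈ A, T x ≤ z := fun z hz => (hT (hx.1 ⟨z, hz, rfl⟩)).trans hz.2
  have hJT : J (T x) ≤ x := hx.2 (by
    rintro _ ⟨z, hz, rfl⟩
    exact hJ (hle z hz))
  have hlox : J lo ≤ x := hx.2 (by
    rintro _ ⟨z, hz, rfl⟩
    exact hJ hz.1.1)
  have hloT : lo ≤ T x := hlo.trans (hT hlox)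
  have hTA : T x ∈ A := ⟨⟨hloT, hle hi hhiA⟩, hT hJT⟩
  have hTTA : T (J (T x)) ∈ A :=
    ⟨⟨hlo.trans (hT (hJ hloT)), (hT hJT).trans hTA.1.2⟩, hT (hJ hTA.2)⟩
  exact ⟨T x, hTA.1, le_antisymm hTA.2 (hle _ hTTA), fun z hz hz' => hle z ⟨hz, hz'⟩⟩

/-- The order dual of `exists_least_fixedPoint_of_isGLB`. -/
theorem exists_greatest_fixedPoint_of_isLUB {S X : Type*} [PartialOrder S] [Preorder X] {J : S → X}
    {T : X → S} (hJ : Monotone J) (hT : Monotone T) {lo hi : S} (hlohi : lo ≤ hi)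
    (hlo : lo ≤ T (J lo)) (hhi : T (J hi) ≤ hi)
    (hlub : ∀ A : Set S, A.Nonempty → A ⊆ Icc lo hi → ∃ x, IsLUB (J '' A) x) :
    ∃ y ∈ Icc lo hi, T (J y) = y ∧ ∀ z ∈ Icc lo hi, z ≤ T (J z) → z ≤ y := by
  obtain ⟨y, hy, h1, h2⟩ := exists_least_fixedPoint_of_isGLB (S := Sᵒᵈ) (X := Xᵒᵈ) (J := J) (T := T)
    hJ.dual hT.dual (lo := OrderDual.toDual hi) (hi := OrderDual.toDual lo) hlohi hhi hlo
    fun A hA hAlh => hlub A hA fun z hz => ⟨(hAlh hz).2, (hAlh hz).1⟩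
  exact ⟨y, ⟨hy.2, hy.1⟩, h1, fun z hz hz' => h2 z ⟨hz.2, hz.1⟩ hz'⟩

/-! ### The Cauchy problem -/

section Problem

variable {m : ℕ} [NeZero m] {b : EReal} [Fact (0 < b)]

/-- The solution `y` of the linear problem `y^(m) = f`, `y^(i)(0) = c i`. -/
noncomputable def SD.integrate (c : Fin m → ℝ) (f : AD b) : SD m b :=
  (SD.exists_of_deriv f c).choose

theorem SD.isDistDeriv_top_integrate (c : Fin m → ℝ) (f : AD b) :
    IsDistDeriv (SD.integrate c f).top.1 f.1 := (SD.exists_of_deriv f c).choose_spec.1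

theorem SD.derivs_integrate_zero (c : Fin m → ℝ) (f : AD b) (i : Fin m) :
    ((SD.integrate c f).derivs i).1 0 = c i := (SD.exists_of_deriv f c).choose_spec.2 i

theorem SD.integrate_mono {c₁ c₂ : Fin m → ℝ} {f₁ f₂ : AD b} (hc : c₁ ≤ c₂) (hf : f₁ ≤ f₂) :
    SD.integrate c₁ f₁ ≤ SD.integrate c₂ f₂ :=
  SD.le_of_deriv_le (SD.isDistDeriv_top_integrate _ _) (SD.isDistDeriv_top_integrate _ _) hf
    fun i => by
    rw [SD.derivs_integrate_zero, SD.derivs_integrate_zero]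
    exact hc i

variable {g : (Fin m → HKloc b) → AD b} {c : Fin m → ℝ} {lo hi y : SD m b}

theorem isSolution_iff : IsSolution g c y ↔ SD.integrate c (g y.jet) = y := by
  constructor
  · rintro ⟨h1, h2⟩
    refine le_antisymm (SD.le_of_deriv_le (SD.isDistDeriv_top_integrate _ _) h1 (AD.le_refl _) ?_)
      (SD.le_of_deriv_le h1 (SD.isDistDeriv_top_integrate _ _) (AD.le_refl _) ?_) <;>
    exact fun i => by rw [SD.derivs_integrate_zero, h2]
  · intro h
    have h1 := SD.isDistDeriv_top_integrate c (g y.jet)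
    have h2 := SD.derivs_integrate_zero c (g y.jet)
    rw [h] at h1 h2
    exact ⟨h1, h2⟩

theorem IsSubsolution.le_integrate (h : IsSubsolution g c y) : y ≤ SD.integrate c (g y.jet) := by
  obtain ⟨⟨f, hf, hfg⟩, h0⟩ := h
  refine SD.le_of_deriv_le hf (SD.isDistDeriv_top_integrate _ _) hfg fun i => ?_
  rw [SD.derivs_integrate_zero]
  exact h0 i

theorem IsSupersolution.integrate_le (h : IsSupersolution g c y) :
    SD.integrate c (g y.jet) ≤ y := by
  obtain ⟨⟨f, hf, hfg⟩, h0⟩ := h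
  refine SD.le_of_deriv_le (SD.isDistDeriv_top_integrate _ _) hf hfg fun i => ?_
  rw [SD.derivs_integrate_zero]
  exact h0 i

theorem exists_least_solution (hg : IsIncreasing g) (hlo : lo ≤ SD.integrate c (g lo.jet))
    (hhi : SD.integrate c (g hi.jet) ≤ hi) (hlohi : lo ≤ hi) :
    ∃ y ∈ solutionsIn g c lo hi, ∀ z ∈ Icc lo hi, SD.integrate c (g z.jet) ≤ z → y ≤ z := by
  obtain ⟨y, hy, h1, h2⟩ := exists_least_fixedPoint_of_isGLB (T := fun x => SD.integrate c (g x))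
    SD.jet_mono (fun x z hxz => SD.integrate_mono le_rfl (hg x z hxz)) hlohi hlo hhi
    fun _ => SD.exists_isGLB_jet
  exact ⟨y, ⟨hy, isSolution_iff.2 h1⟩, h2⟩

theorem exists_greatest_solution (hg : IsIncreasing g) (hlo : lo ≤ SD.integrate c (g lo.jet))
    (hhi : SD.integrate c (g hi.jet) ≤ hi) (hlohi : lo ≤ hi) :
    ∃ y ∈ solutionsIn g c lo hi, ∀ z ∈ Icc lo hi, z ≤ SD.integrate c (g z.jet) → z ≤ y := by
  obtain ⟨y, hy, h1, h2⟩ := exists_greatest_fixedPoint_of_isLUB (T := fun x => SD.integrate c (g x))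
    SD.jet_mono (fun x z hxz => SD.integrate_mono le_rfl (hg x z hxz)) hlohi hlo hhi
    fun _ => SD.exists_isLUB_jet
  exact ⟨y, ⟨hy, isSolution_iff.2 h1⟩, h2⟩

end Problem

end DistCauchy

theorem theorem6p1 (m : ℕ) [NeZero m] (b : EReal) [Fact (0 < b)] :
    (∀ (g : (Fin m → DistCauchy.HKloc b) → DistCauchy.AD b) (c : Fin m → ℝ)
      (lo hi : DistCauchy.SD m b),
      DistCauchy.IsIncreasing g →
      DistCauchy.IsSubsolution g c lo → DistCauchy.IsSupersolution g c hi → lo ≤ hi →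
      (∃ y, IsLeast (DistCauchy.solutionsIn g c lo hi) y) ∧
      (∃ y, IsGreatest (DistCauchy.solutionsIn g c lo hi) y)) ∧
    (∀ (g₁ g₂ : (Fin m → DistCauchy.HKloc b) → DistCauchy.AD b) (c₁ c₂ : Fin m → ℝ)
      (lo hi : DistCauchy.SD m b),
      DistCauchy.IsIncreasing g₁ → DistCauchy.IsIncreasing g₂ →
      DistCauchy.IsSubsolution g₁ c₁ lo → DistCauchy.IsSupersolution g₂ c₂ hi → lo ≤ hi →
      (∀ x, g₁ x ≤ g₂ x) → c₁ ≤ c₂ →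
      (∀ y₁ y₂, IsLeast (DistCauchy.solutionsIn g₁ c₁ lo hi) y₁ →
        IsLeast (DistCauchy.solutionsIn g₂ c₂ lo hi) y₂ → y₁ ≤ y₂) ∧
      (∀ y₁ y₂, IsGreatest (DistCauchy.solutionsIn g₁ c₁ lo hi) y₁ →
        IsGreatest (DistCauchy.solutionsIn g₂ c₂ lo hi) y₂ → y₁ ≤ y₂)) := by
  refine ⟨fun g c lo hi hg hlo hhi hlohi => ⟨?_, ?_⟩,
    fun g₁ g₂ c₁ c₂ lo hi hg₁ hg₂ hlo hhi hlohi hg hc => ⟨?_, ?_⟩⟩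
  · obtain ⟨y, hy, hle⟩ :=
      DistCauchy.exists_least_solution hg hlo.le_integrate hhi.integrate_le hlohi
    exact ⟨y, hy, fun z hz => hle z hz.1 (DistCauchy.isSolution_iff.1 hz.2).le⟩
  · obtain ⟨y, hy, hle⟩ :=
      DistCauchy.exists_greatest_solution hg hlo.le_integrate hhi.integrate_le hlohi
    exact ⟨y, hy, fun z hz => hle z hz.1 (DistCauchy.isSolution_iff.1 hz.2).ge⟩
  · intro y₁ y₂ hy₁ hy₂
    obtain ⟨y, hy, hle⟩ := DistCauchy.exists_least_solution hg₁ hlo.le_integrate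
      ((DistCauchy.SD.integrate_mono hc (hg _)).trans hhi.integrate_le) hlohi
    -- A solution of the larger problem is a supersolution of the smaller one.
    exact (hy₁.2 hy).trans (hle y₂ hy₂.1.1 ((DistCauchy.SD.integrate_mono hc (hg _)).trans
      (DistCauchy.isSolution_iff.1 hy₂.1.2).le))
  · intro y₁ y₂ hy₁ hy₂
    obtain ⟨y, hy, hle⟩ := DistCauchy.exists_greatest_solution hg₂
      (hlo.le_integrate.trans (DistCauchy.SD.integrate_mono hc (hg _))) hhi.integrate_le hlohi
    -- A solution of the smaller problem is a subsolution of the larger one.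
    exact (hle y₁ hy₁.1.1 ((DistCauchy.isSolution_iff.1 hy₁.1.2).ge.trans
      (DistCauchy.SD.integrate_mono hc (hg _)))).trans (hy₂.2 hy)
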